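/- Everything is $C^\infty$; manifolds are finite-dimensional, Hausdorff, second countable and without boundary. For a non-degenerate $2$-covariant tensor $B$ put $\flat_B X=B(X,\cdot)$ and $\sharp_B=\flat_B^{-1}$. A (pseudo-)Riemannian metric is a symmetric non-degenerate $2$-covariant tensor field, an almost symplectic form is a non-degenerate $2$-form. An almost (pseudo-)Hermitian structure with fundamental form $\omega$ is a pair $(J,\gamma)$ with $J\in\mathrm{End}(TM)$, $J^2=-\mathrm{Id}$, $\gamma$ a (pseudo-)Riemannian metric, $\gamma(JX,JY)=\gamma(X,Y)$ and $\omega(X,Y)=\gamma(X,JY)$; it is (pseudo-)Kähler if the Nijenhuis tensor of $J$ vanishes and $d\omega=0$. An almost para-Hermitian structure is a pair $(F,\gamma)$ with $F^2=\mathrm{Id}$, $\pm1$-eigenbundles $L_\pm$ of $F$ of equal rank, and $\gamma(FX,Y)=-\gamma(X,FY)$; the form belonging to it is $\omega(X,Y)=\gamma(FX,Y)$; it is para-Kähler if $L_\pm$ are integrable (involutive) and $d\omega=0$. **Proposition 5.2.** Let $(M,\omega)$ be an almost symplectic manifold with a (pseudo-)Riemannian metric $\gamma$ satisfying one of the two conditions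 $$\sharp_\omega\circ\flat_\gamma=\mp\,\sharp_\gamma\circ\flat_\omega .$$ (A) For the minus sign, $J=\sharp_\omega\circ\flat_\gamma$ and $\gamma$ form an almost (pseudo-)Hermitian structure with fundamental form $\omega$. For the plus sign, $F=\sharp_\omega\circ\flat_\gamma$ and $\gamma$ form an almost para-Hermitian structure with $\omega(X,Y)=\gamma(FX,Y)$. (B) Let $\iota:N\to M$ be a submanifold (an injective immersion) such that $\iota^*\omega$ has constant rank $2r$, let $K=TN\cap T^{\perp_\omega}N$, and assume: 1. $K$ is tangent to a foliation $\mathcal K$; 2. locally, $K$ is spanned by infinitesimal automorphisms of $\iota^*\omega$, i.e. by vector fields $X$ with $\mathfrak L_X(\iota^*\omega)=0$; 3. $Q$ is a manifold of dimension $2r$ and $p:N\to Q$ is a surjective submersion with connected fibres that is constant on the leaves of $\mathcal K$ (so $Q$ is the space of leaves). Assume also that $\iota^*\gamma$ is non-degenerate on $TN$ and on $K$, that $\lambda$ is a (pseudo-)Riemannian metric on $Q$ with $\iota^*\gamma=p^*\lambda$ on $K'=TN\cap K^{\perp_\gamma}$, and that $$K'^{\perp_\gamma}=K'^{\perp_\omega}$$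 (orthogonals in $TM|_N$). Then there is a unique tensor field $\varpi$ on $Q$ with $p^*\varpi=\iota^*\omega$; it is an almost symplectic form. For the minus sign, $(\sharp_\varpi\circ\flat_\lambda,\lambda)$ is an almost (pseudo-)Hermitian structure on $Q$ with fundamental form $\varpi$. For the plus sign, $(\sharp_\varpi\circ\flat_\lambda,\lambda)$ is an almost para-Hermitian structure on $Q$ whose form, in the sense above, is $\varpi$. If $M$, with the structure of (A), is (pseudo-)Kähler, respectively para-Kähler, then so is $Q$ with this structure. If $\gamma$ is positive definite, so is $\lambda$. -/

import Mathlib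

open Set Function
open scoped Manifold

noncomputable section

namespace SymplecticReduction

/-! Throughout, a manifold is a boundaryless smooth manifold `M` modelled on a normed space `E`;
its tangent space at `x` is `TangentSpace 𝓘(ℝ, E) x`. -/

section LinearAlgebra

variable {V : Type*} [AddCommGroup V] [Module ℝ V] [TopologicalSpace V]

/-- The orthogonal `S^⊥ = {v | B(v, w) = 0 for all w ∈ S}` of a subspace with respect to a
bilinear form (for symmetric or alternating `B` left and right orthogonals agree). -/
def orth (B : V →L[ℝ] V →L[ℝ] ℝ) (S : Submodule ℝ V) : Submodule ℝ V where
  carrier := {v | ∀ w ∈ S, B v w = 0}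
  zero_mem' := by
    intro w _
    simp
  add_mem' := by
    intro a b ha hb w hw
    simp [ha w hw, hb w hw]
  smul_mem' := by
    intro c a ha w hw
    simp [ha w hw]

/-- The restriction of the bilinear form `B` to the subspace `S` is non degenerate. -/
def NondegenerateOn (B : V →L[ℝ] V →L[ℝ] ℝ) (S : Submodule ℝ V) : Prop :=
  ∀ v ∈ S, (∀ w ∈ S, B v w = 0) → v = 0

end LinearAlgebra

section Fields

variable (E : Type*) [NormedAddCommGroup E] [NormedSpace ℝ E]
  (M : Type*) [TopologicalSpace M] [ChartedSpace E M]

/-- Vector fields (no regularity). -/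
abbrev VectorField := ∀ x : M, TangentSpace 𝓘(ℝ, E) x

/-- Two times covariant tensor fields (no regularity). -/
abbrev Bilin := ∀ x : M, TangentSpace 𝓘(ℝ, E) x →L[ℝ] TangentSpace 𝓘(ℝ, E) x →L[ℝ] ℝ

/-- Fields of endomorphisms of the tangent bundle (no regularity). -/
abbrev Endo := ∀ x : M, TangentSpace 𝓘(ℝ, E) x →L[ℝ] TangentSpace 𝓘(ℝ, E) x

/-- Fields of tangent subspaces. -/
abbrev Distribution := ∀ x : M, Submodule ℝ (TangentSpace 𝓘(ℝ, E) x)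

end Fields

section Calculus

variable {E : Type*} [NormedAddCommGroup E] [NormedSpace ℝ E]
  {M : Type*} [TopologicalSpace M] [ChartedSpace E M] [IsManifold 𝓘(ℝ, E) ((⊤ : ℕ∞) : WithTop ℕ∞) M]

/-- The vector field `X` is smooth on `U`. -/
def SmoothVF (X : VectorField E M) (U : Set M) : Prop :=
  ContMDiffOn 𝓘(ℝ, E) 𝓘(ℝ, E).tangent ((⊤ : ℕ∞) : WithTop ℕ∞)
    (fun x ↦ (⟨x, X x⟩ : TangentBundle 𝓘(ℝ, E) M)) U

/-- `B` is a smooth section of the bundle of bilinear forms on the tangent bundle. -/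
def SmoothBilin (B : Bilin E M) : Prop :=
  ContMDiff 𝓘(ℝ, E) (𝓘(ℝ, E).prod 𝓘(ℝ, E →L[ℝ] E →L[ℝ] ℝ)) ((⊤ : ℕ∞) : WithTop ℕ∞)
    (fun x ↦ Bundle.TotalSpace.mk' (E →L[ℝ] E →L[ℝ] ℝ)
      (E := fun x : M ↦ TangentSpace 𝓘(ℝ, E) x →L[ℝ] TangentSpace 𝓘(ℝ, E) x →L[ℝ] ℝ) x (B x))

/-- `A` is a smooth section of the bundle of endomorphisms of the tangent bundle. -/
def SmoothEndo (A : Endo E M) : Prop :=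
  ContMDiff 𝓘(ℝ, E) (𝓘(ℝ, E).prod 𝓘(ℝ, E →L[ℝ] E)) ((⊤ : ℕ∞) : WithTop ℕ∞)
    (fun x ↦ Bundle.TotalSpace.mk' (E →L[ℝ] E)
      (E := fun x : M ↦ TangentSpace 𝓘(ℝ, E) x →L[ℝ] TangentSpace 𝓘(ℝ, E) x) x (A x))

/-- The derivative `v f` of a function at `x` in the direction of `v ∈ T_x M`. -/
def dirDeriv (f : M → ℝ) (x : M) (v : TangentSpace 𝓘(ℝ, E) x) : ℝ :=
  mfderiv 𝓘(ℝ, E) 𝓘(ℝ, ℝ) f x v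

/-- The Lie bracket `[X, Y]` of vector fields. -/
abbrev bracket (X Y : VectorField E M) : VectorField E M :=
  VectorField.mlieBracket 𝓘(ℝ, E) X Y

/-- The function `B(X, Y)`. -/
abbrev evalBilin (B : Bilin E M) (X Y : VectorField E M) : M → ℝ := fun x ↦ B x (X x) (Y x)

/-- The vector field `A X`. -/
abbrev evalEndo (A : Endo E M) (X : VectorField E M) : VectorField E M := fun x ↦ A x (X x)

/-- `L_X B = 0` on the open set `U`, where
`(L_X B)(Y, Z) = X(B(Y, Z)) - B([X, Y], Z) - B(Y, [X, Z])`: `X` is an infinitesimal automorphism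
of `B` on `U`. -/
def IsInfinitesimalAutomorphism (B : Bilin E M) (X : VectorField E M) (U : Set M) : Prop :=
  ∀ V : Set M, IsOpen V → V ⊆ U → ∀ Y Z : VectorField E M, SmoothVF Y V → SmoothVF Z V →
    ∀ x ∈ V, dirDeriv (evalBilin B Y Z) x (X x)
      - B x (bracket X Y x) (Z x) - B x (Y x) (bracket X Z x) = 0

/-- `dω = 0` for a `2`-form `ω`, where
`dω(X, Y, Z) = X(ω(Y, Z)) - Y(ω(X, Z)) + Z(ω(X, Y)) - ω([X, Y], Z) + ω([X, Z], Y) - ω([Y, Z], X)`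
for all local smooth vector fields. -/
def IsClosedForm (ω : Bilin E M) : Prop :=
  ∀ U : Set M, IsOpen U → ∀ X Y Z : VectorField E M,
    SmoothVF X U → SmoothVF Y U → SmoothVF Z U → ∀ x ∈ U,
      dirDeriv (evalBilin ω Y Z) x (X x) - dirDeriv (evalBilin ω X Z) x (Y x)
        + dirDeriv (evalBilin ω X Y) x (Z x)
        - ω x (bracket X Y x) (Z x) + ω x (bracket X Z x) (Y x)
        - ω x (bracket Y Z x) (X x) = 0

/-- The Nijenhuis tensor
`N_J(X, Y) = [JX, JY] - J[JX, Y] - J[X, JY] + J²[X, Y]` vanishes. -/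
def NijenhuisVanishes (J : Endo E M) : Prop :=
  ∀ U : Set M, IsOpen U → ∀ X Y : VectorField E M, SmoothVF X U → SmoothVF Y U → ∀ x ∈ U,
    bracket (evalEndo J X) (evalEndo J Y) x - J x (bracket (evalEndo J X) Y x)
      - J x (bracket X (evalEndo J Y) x) + J x (J x (bracket X Y x)) = 0

/-- The distribution `D` is integrable: it is involutive, i.e. closed under the bracket of
local smooth vector fields. For a smooth distribution of constant rank this says that `D` is
tangent to a foliation. -/
def IsIntegrable (D : Distribution E M) : Prop :=
  ∀ U : Set M, IsOpen U → ∀ X Y : VectorField E M, SmoothVF X U → SmoothVF Y U →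
    (∀ x ∈ U, X x ∈ D x) → (∀ x ∈ U, Y x ∈ D x) → ∀ x ∈ U, bracket X Y x ∈ D x

/-- `x` and `y` lie on the same leaf of the foliation tangent to `D`: they are joined by finitely
many differentiable arcs tangent to `D`. -/
def SameLeaf (D : Distribution E M) : M → M → Prop :=
  Relation.ReflTransGen fun x y ↦ ∃ c : ℝ → M, MDifferentiable 𝓘(ℝ, ℝ) 𝓘(ℝ, E) c ∧
    (∀ t : ℝ, mfderiv 𝓘(ℝ, ℝ) 𝓘(ℝ, E) c t (1 : ℝ) ∈ D (c t)) ∧ c 0 = x ∧ c 1 = y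

/-- `B` is non degenerate at every point. -/
def Nondegenerate (B : Bilin E M) : Prop := ∀ x, NondegenerateOn (B x) ⊤

/-- An almost symplectic form: a smooth non degenerate `2`-form. -/
structure IsAlmostSymplectic (ω : Bilin E M) : Prop where
  smooth : SmoothBilin ω
  alternating : ∀ x v, ω x v v = 0
  nondegenerate : Nondegenerate ω

/-- A (pseudo-)Riemannian metric: a smooth symmetric non degenerate `2`-covariant tensor field. -/
structure IsPseudoMetric (γ : Bilin E M) : Prop where
  smooth : SmoothBilin γ
  symm : ∀ x v w, γ x v w = γ x w v
  nondegenerate : Nondegenerate γ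

/-- `γ` is positive definite. -/
def PositiveDefinite (γ : Bilin E M) : Prop := ∀ x v, v ≠ 0 → 0 < γ x v v

/-- `♭_B : T_x M → T_x^* M`, `v ↦ B(v, ·)`. -/
def flat (B : Bilin E M) (x : M) :
    TangentSpace 𝓘(ℝ, E) x →L[ℝ] (TangentSpace 𝓘(ℝ, E) x →L[ℝ] ℝ) := B x

/-- `♯_B : T_x^* M → T_x M`, the inverse of `♭_B` (used for non degenerate `B`). -/
def sharp (B : Bilin E M) (x : M) :
    (TangentSpace 𝓘(ℝ, E) x →L[ℝ] ℝ) →L[ℝ] TangentSpace 𝓘(ℝ, E) x := (flat B x).inverse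

/-- The field of endomorphisms `♯_ω ∘ ♭_γ`. -/
def structureEndo (ω γ : Bilin E M) : Endo E M := fun x ↦ sharp ω x ∘L flat γ x

/-- `(J, γ)` is an almost (pseudo-)Hermitian structure with fundamental form
`ω(X, Y) = γ(X, JY)`. -/
structure IsAlmostHermitian (J : Endo E M) (γ ω : Bilin E M) : Prop where
  metric : IsPseudoMetric γ
  smooth : SmoothEndo J
  sq : ∀ x v, J x (J x v) = -v
  compatible : ∀ x v w, γ x (J x v) (J x w) = γ x v w
  fundamental : ∀ x v w, ω x v w = γ x v (J x w)

/-- `(J, γ)` is a (pseudo-)Kähler structure with fundamental form `ω`. -/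
structure IsKahler (J : Endo E M) (γ ω : Bilin E M) : Prop
    extends IsAlmostHermitian J γ ω where
  integrable : NijenhuisVanishes J
  closed : IsClosedForm ω

/-- The eigendistribution of `F` for the eigenvalue `c`. -/
def eigenDistribution (F : Endo E M) (c : ℝ) : Distribution E M :=
  fun x ↦ LinearMap.ker ((F x - c • ContinuousLinearMap.id ℝ (TangentSpace 𝓘(ℝ, E) x) :
    TangentSpace 𝓘(ℝ, E) x →L[ℝ] TangentSpace 𝓘(ℝ, E) x) :
    TangentSpace 𝓘(ℝ, E) x →ₗ[ℝ] TangentSpace 𝓘(ℝ, E) x)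

/-- `(F, γ)` is an almost para-Hermitian structure, and `ω(X, Y) = γ(FX, Y)`, i.e.
`ω(X, Y) = -γ(X, FY)`. -/
structure IsAlmostParaHermitian (F : Endo E M) (γ ω : Bilin E M) : Prop where
  metric : IsPseudoMetric γ
  smooth : SmoothEndo F
  sq : ∀ x v, F x (F x v) = v
  equal_rank : ∀ x, Module.finrank ℝ (eigenDistribution F 1 x)
    = Module.finrank ℝ (eigenDistribution F (-1) x)
  compatible : ∀ x v w, γ x (F x v) w = -γ x v (F x w)
  fundamental : ∀ x v w, ω x v w = γ x (F x v) w

/-- `(F, γ)` is a para-Kähler structure: the eigendistributions of `F` are integrable and the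
fundamental form is closed. -/
structure IsParaKahler (F : Endo E M) (γ ω : Bilin E M) : Prop
    extends IsAlmostParaHermitian F γ ω where
  integrable_pos : IsIntegrable (eigenDistribution F 1)
  integrable_neg : IsIntegrable (eigenDistribution F (-1))
  closed : IsClosedForm ω

end Calculus

section Reduction

variable {E : Type*} [NormedAddCommGroup E] [NormedSpace ℝ E]
  {M : Type*} [TopologicalSpace M] [ChartedSpace E M]
  {E' : Type*} [NormedAddCommGroup E'] [NormedSpace ℝ E']
  {N : Type*} [TopologicalSpace N] [ChartedSpace E' N]

variable (E E') in
/-- The differential of `f : N → M` at `y`. -/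
abbrev diff (f : N → M) (y : N) :
    TangentSpace 𝓘(ℝ, E') y →L[ℝ] TangentSpace 𝓘(ℝ, E) (f y) :=
  mfderiv 𝓘(ℝ, E') 𝓘(ℝ, E) f y

variable (E E') in
/-- The differential of `f : N → M` at `y`, as a linear map. -/
abbrev diffₗ (f : N → M) (y : N) :
    TangentSpace 𝓘(ℝ, E') y →ₗ[ℝ] TangentSpace 𝓘(ℝ, E) (f y) :=
  (diff E E' f y : TangentSpace 𝓘(ℝ, E') y →L[ℝ] TangentSpace 𝓘(ℝ, E) (f y))

variable (E') in
/-- The pullback `(f^* B)(v, w) = B(df v, df w)`. -/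
def pullback (f : N → M) (B : Bilin E M) : Bilin E' N := fun y ↦
  (ContinuousLinearMap.precomp ℝ (diff E E' f y)) ∘L
    (B (f y)) ∘L (diff E E' f y)

variable (E') in
/-- `K = TN ∩ T^{⊥ω}N`, as a field of subspaces of the tangent spaces of `N`. -/
def distK (ω : Bilin E M) (ι : N → M) : Distribution E' N := fun y ↦
  (orth (ω (ι y)) (LinearMap.range (diffₗ E E' ι y))).comap (diffₗ E E' ι y)

variable (E') in
/-- `K' = TN ∩ K^{⊥γ}`, as a field of subspaces of the tangent spaces of `N`. -/
def distK' (ω γ : Bilin E M) (ι : N → M) : Distribution E' N := fun y ↦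
  (orth (γ (ι y)) ((distK E' ω ι y).map (diffₗ E E' ι y))).comap (diffₗ E E' ι y)

variable {E'' : Type*} [NormedAddCommGroup E''] [NormedSpace ℝ E'']
  {Q : Type*} [TopologicalSpace Q] [ChartedSpace E'' Q]
  [IsManifold 𝓘(ℝ, E') ((⊤ : ℕ∞) : WithTop ℕ∞) N]

variable (E' E'') in
/-- The conditions under which `ι : N → M` (a submanifold such that `ι^*ω` has constant rank `2r`)
reduces the almost symplectic manifold `(M, ω)` to the manifold `Q`, by the fibration
`p : N → Q`. -/
structure IsSymplecticReduction (ω : Bilin E M) (ι : N → M) (p : N → Q) (r : ℕ) : Prop where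
  immersion : Manifold.IsImmersion 𝓘(ℝ, E') 𝓘(ℝ, E) ((⊤ : ℕ∞) : WithTop ℕ∞) ι
  injective : Injective ι
  constant_rank : ∀ y, Module.finrank ℝ (LinearMap.range
    (pullback E' ι ω y : TangentSpace 𝓘(ℝ, E') y →ₗ[ℝ] (TangentSpace 𝓘(ℝ, E') y →L[ℝ] ℝ))) = 2 * r
  /-- `K` is tangent to a foliation -/
  foliation : IsIntegrable (distK E' ω ι)
  /-- locally, `K` is spanned by infinitesimal automorphisms of `ι^*ω` -/
  automorphisms : ∀ y : N, ∃ U : Set N, IsOpen U ∧ y ∈ U ∧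
    ∃ (k : ℕ) (X : Fin k → VectorField E' N),
      (∀ i, SmoothVF (X i) U) ∧
      (∀ i, IsInfinitesimalAutomorphism (pullback E' ι ω) (X i) U) ∧
      ∀ z ∈ U, distK E' ω ι z = Submodule.span ℝ (range fun i ↦ X i z)
  dim_quotient : Module.finrank ℝ E'' = 2 * r
  submersion : Manifold.IsSubmersion 𝓘(ℝ, E') 𝓘(ℝ, E'') ((⊤ : ℕ∞) : WithTop ℕ∞) p
  surjective : Surjective p
  constant_on_leaves : ∀ x y : N, SameLeaf (distK E' ω ι) x y → p x = p y
  /-- `Q` is the space of leaves -/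
  connected_fibres : ∀ q : Q, IsPreconnected (p ⁻¹' {q})

variable (E') in
/-- The conditions under which the metric `γ` of `M` reduces to the metric `lam` of `Q`. -/
structure IsMetricReduction (ω γ : Bilin E M) (ι : N → M) (p : N → Q) (lam : Bilin E'' Q) :
    Prop where
  /-- `g_N = ι^*γ` is non degenerate -/
  nondegenerate_N : Nondegenerate (pullback E' ι γ)
  /-- `g_K` is non degenerate -/
  nondegenerate_K : ∀ y : N, NondegenerateOn (pullback E' ι γ y) (distK E' ω ι y)
  /-- `g_{K'} = p^* lam` -/
  projects : ∀ y : N, ∀ v ∈ distK' E' ω γ ι y, ∀ w ∈ distK' E' ω γ ι y,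
    pullback E' ι γ y v w = pullback E' p lam y v w

variable (E') in
/-- The condition `K'^{⊥γ} = K'^{⊥ω}` (orthogonals in the tangent spaces of `M` along `N`). -/
def OrthCondition (ω γ : Bilin E M) (ι : N → M) : Prop :=
  ∀ y : N,
    orth (γ (ι y)) ((distK' E' ω γ ι y).map (diffₗ E E' ι y))
    = orth (ω (ι y)) ((distK' E' ω γ ι y).map (diffₗ E E' ι y))

end Reduction

end SymplecticReduction

end

open Set Function
open scoped Manifold

noncomputable section

namespace SymplecticReduction

set_option linter.unusedSectionVars false

open Bundle Filter Topology VectorField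
-- Write `A = ♯_ω ∘ ♭_γ` on `M` and `A' = ♯_ϖ ∘ ♭_λ` on `Q`; "vertical" means in `ker dp`,
-- "horizontal" means in `K'`.
--
-- The reduced form. The radical `K` of `ι^*ω` is exactly `ker dp`: constancy on leaves gives one
-- inclusion, and both spaces have codimension `2r` (`distK_eq_ker`). Invariance under the vertical
-- automorphisms makes the components of `ι^*ω` constant along the fibres in a submersion chart, and
-- connected fibres turn this into descent (`exists_pullback_eq`). For a local section `s` of `p`
-- the reduced form is `(ι ∘ s)^*ω`, whence smoothness and closedness.
--
-- The endomorphism. If `h` is horizontal and `u` lies in `K'^{⊥ω} = K'^{⊥γ}`, then `ω(Ah, u) = γ(h,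
-- u) = 0`, so `Ah` lies in the double `ω`-orthogonal of `K'`, which is `K'`. Thus `A` preserves
-- `K'` and induces `A'` there (`exists_lift_endo`). The identity `γ(A·, ·) = εω` with `ε = ∓1`
-- therefore descends to `λ(A'·, ·) = εϖ`, which yields the almost Hermitian or almost
-- para-Hermitian structure exactly as on `M`.
--
-- Integrability. The bracket of horizontal lifts is the lift of the bracket up to a vertical
-- vector. Hence the Nijenhuis tensor of `A` on lifts is the lift of that of `A'` plus terms in `K`,
-- `AK` and `A²K`. Such terms may leave `TN`, so they cannot be projected away; but `A` is `γ`-skew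
-- and preserves `K'`, so they are all `γ`-orthogonal to `K'`, where `γ` is `p^*λ` and
-- non-degenerate (`coordNijenhuis_descend`). The para-Kähler case reduces to this one, because the
-- eigendistributions of an involution are integrable exactly when its Nijenhuis tensor vanishes.
local notation "∞" => ((⊤ : ℕ∞) : WithTop ℕ∞)

/-! ### Smoothness of tensors evaluated along maps -/

section SmoothAlong

variable {E : Type*} [NormedAddCommGroup E] [NormedSpace ℝ E]
  {M : Type*} [TopologicalSpace M] [ChartedSpace E M] [IsManifold 𝓘(ℝ, E) ∞ M]
  {F : Type*} [NormedAddCommGroup F] [NormedSpace ℝ F]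
  {P : Type*} [TopologicalSpace P] [ChartedSpace F P] [IsManifold 𝓘(ℝ, F) ∞ P]

/-- The differential of a smooth map applied to a smooth vector field is smooth. -/
lemma contMDiffAt_mfderiv_apply {f : P → M} {p : P} {X : VectorField F P}
    (hf : ContMDiffAt 𝓘(ℝ, F) 𝓘(ℝ, E) ∞ f p)
    (hX : ContMDiffAt 𝓘(ℝ, F) 𝓘(ℝ, F).tangent ∞
      (fun x ↦ (⟨x, X x⟩ : TangentBundle 𝓘(ℝ, F) P)) p) :
    ContMDiffAt 𝓘(ℝ, F) 𝓘(ℝ, E).tangent ∞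
      (fun x ↦ (⟨f x, mfderiv 𝓘(ℝ, F) 𝓘(ℝ, E) f x (X x)⟩ : TangentBundle 𝓘(ℝ, E) M)) p :=
  ContMDiffAt.clm_apply_of_inCoordinates (hf.mfderiv_const le_rfl) hX hf

lemma contMDiffAt_mfderiv_const {f : F → M} {p : F} (u : F)
    (hf : ContMDiffAt 𝓘(ℝ, F) 𝓘(ℝ, E) ∞ f p) :
    ContMDiffAt 𝓘(ℝ, F) 𝓘(ℝ, E).tangent ∞
      (fun x ↦ (⟨f x, mfderiv 𝓘(ℝ, F) 𝓘(ℝ, E) f x u⟩ : TangentBundle 𝓘(ℝ, E) M)) p :=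
  contMDiffAt_mfderiv_apply (X := fun _ ↦ u) hf
    (contMDiffAt_vectorSpace_iff_contDiffAt.2 contDiffAt_const)

/-- The value of a smooth bilinear form on smooth vector fields along a map is smooth. -/
lemma SmoothBilin.contMDiffAt_apply {B : Bilin E M} (hB : SmoothBilin B) {f : P → M} {p : P}
    {v w : ∀ x : P, TangentSpace 𝓘(ℝ, E) (f x)}
    (hv : ContMDiffAt 𝓘(ℝ, F) 𝓘(ℝ, E).tangent ∞
      (fun x ↦ (⟨f x, v x⟩ : TangentBundle 𝓘(ℝ, E) M)) p)
    (hw : ContMDiffAt 𝓘(ℝ, F) 𝓘(ℝ, E).tangent ∞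
      (fun x ↦ (⟨f x, w x⟩ : TangentBundle 𝓘(ℝ, E) M)) p) :
    ContMDiffAt 𝓘(ℝ, F) 𝓘(ℝ, ℝ) ∞ (fun x ↦ B (f x) (v x) (w x)) p := by
  have hf : ContMDiffAt 𝓘(ℝ, F) 𝓘(ℝ, E) ∞ f p := (contMDiffAt_totalSpace.1 hv).1
  have h1 := (hB (f p)).comp p hf
  have h2 := ContMDiffAt.clm_bundle_apply₂ (F₁ := E) (F₂ := E) (F₃ := ℝ)
    (E₁ := TangentSpace 𝓘(ℝ, E)) (E₂ := TangentSpace 𝓘(ℝ, E)) (E₃ := Bundle.Trivial M ℝ)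
    (b := f) (ψ := fun x ↦ B (f x)) h1 hv hw
  exact (contMDiffAt_totalSpace.1 h2).2

lemma SmoothEndo.contMDiffAt_apply {A : Endo E M} (hA : SmoothEndo A) {f : P → M} {p : P}
    {v : ∀ x : P, TangentSpace 𝓘(ℝ, E) (f x)}
    (hv : ContMDiffAt 𝓘(ℝ, F) 𝓘(ℝ, E).tangent ∞
      (fun x ↦ (⟨f x, v x⟩ : TangentBundle 𝓘(ℝ, E) M)) p) :
    ContMDiffAt 𝓘(ℝ, F) 𝓘(ℝ, E).tangent ∞
      (fun x ↦ (⟨f x, A (f x) (v x)⟩ : TangentBundle 𝓘(ℝ, E) M)) p := by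
  have hf : ContMDiffAt 𝓘(ℝ, F) 𝓘(ℝ, E) ∞ f p := (contMDiffAt_totalSpace.1 hv).1
  have h1 := (hA (f p)).comp p hf
  exact ContMDiffAt.clm_bundle_apply (F₁ := E) (F₂ := E)
    (E₁ := TangentSpace 𝓘(ℝ, E)) (E₂ := TangentSpace 𝓘(ℝ, E))
    (b := f) (ϕ := fun x ↦ A (f x)) h1 hv

end SmoothAlong

/-! ### Smoothness of bundle maps tested on sections -/

section Criterion

variable {EB : Type*} [NormedAddCommGroup EB] [NormedSpace ℝ EB]
  {B : Type*} [TopologicalSpace B] [ChartedSpace EB B]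
  {F₁ F₂ : Type*} [NormedAddCommGroup F₁] [NormedSpace ℝ F₁] [FiniteDimensional ℝ F₁]
  [NormedAddCommGroup F₂] [NormedSpace ℝ F₂]
  {E₁ E₂ : B → Type*} [∀ x, AddCommGroup (E₁ x)] [∀ x, Module ℝ (E₁ x)]
  [∀ x, AddCommGroup (E₂ x)] [∀ x, Module ℝ (E₂ x)]
  [TopologicalSpace (TotalSpace F₁ E₁)] [∀ x, TopologicalSpace (E₁ x)]
  [TopologicalSpace (TotalSpace F₂ E₂)] [∀ x, TopologicalSpace (E₂ x)]
  [FiberBundle F₁ E₁] [VectorBundle ℝ F₁ E₁] [FiberBundle F₂ E₂] [VectorBundle ℝ F₂ E₂]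
  [∀ x, IsTopologicalAddGroup (E₂ x)] [∀ x, ContinuousSMul ℝ (E₂ x)]
  [∀ x, IsTopologicalAddGroup (E₁ x)] [∀ x, ContinuousSMul ℝ (E₁ x)]
  [ContMDiffVectorBundle ∞ F₁ E₁ 𝓘(ℝ, EB)]

/-- Since `F` is finite-dimensional, a basis identifies `F →L[ℝ] G` with a finite power of `G`,
where smoothness is coordinatewise. -/
lemma contMDiffAt_clm_of_apply {F G : Type*}
    [NormedAddCommGroup F] [NormedSpace ℝ F] [FiniteDimensional ℝ F]
    [NormedAddCommGroup G] [NormedSpace ℝ G] {A : B → F →L[ℝ] G} {x : B}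
    (h : ∀ u, ContMDiffAt 𝓘(ℝ, EB) 𝓘(ℝ, G) ∞ (fun y ↦ A y u) x) :
    ContMDiffAt 𝓘(ℝ, EB) 𝓘(ℝ, F →L[ℝ] G) ∞ A x := by
  let d := Module.finrank ℝ F
  have hd : d = Module.finrank ℝ (Fin d → ℝ) := (Module.finrank_fin_fun ℝ).symm
  let e₁ := ContinuousLinearEquiv.ofFinrankEq hd
  let e₂ := (e₁.arrowCongr (1 : G ≃L[ℝ] G)).trans (ContinuousLinearEquiv.piRing (Fin d))
  rw [← id_comp A, ← e₂.symm_comp_self]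
  exact e₂.symm.contDiff.contMDiff.contMDiffAt.comp x (contMDiffAt_pi_space.mpr fun i ↦ h _)

lemma contDiffAt_clm_of_apply {D F G : Type*} [NormedAddCommGroup D] [NormedSpace ℝ D]
    [NormedAddCommGroup F] [NormedSpace ℝ F] [FiniteDimensional ℝ F]
    [NormedAddCommGroup G] [NormedSpace ℝ G] {A : D → F →L[ℝ] G} {x : D}
    (h : ∀ u, ContDiffAt ℝ ∞ (fun y ↦ A y u) x) : ContDiffAt ℝ ∞ A x :=
  contMDiffAt_iff_contDiffAt.1 <| contMDiffAt_clm_of_apply fun u ↦ (h u).contMDiffAt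

/-- A field of linear maps between vector bundles is smooth if it maps smooth sections to smooth
sections. -/
lemma contMDiffAt_hom_of_apply {A : ∀ x : B, E₁ x →L[ℝ] E₂ x} {x₀ : B}
    (h : ∀ X : ∀ x : B, E₁ x,
      ContMDiffAt 𝓘(ℝ, EB) (𝓘(ℝ, EB).prod 𝓘(ℝ, F₁)) ∞ (fun x ↦ TotalSpace.mk' F₁ x (X x)) x₀ →
      ContMDiffAt 𝓘(ℝ, EB) (𝓘(ℝ, EB).prod 𝓘(ℝ, F₂)) ∞
        (fun x ↦ TotalSpace.mk' F₂ x (A x (X x))) x₀) :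
    ContMDiffAt 𝓘(ℝ, EB) (𝓘(ℝ, EB).prod 𝓘(ℝ, F₁ →L[ℝ] F₂)) ∞
      (fun x ↦ TotalSpace.mk' (F₁ →L[ℝ] F₂) (E := fun x ↦ E₁ x →L[ℝ] E₂ x) x (A x)) x₀ := by
  rw [contMDiffAt_hom_bundle]
  refine ⟨contMDiffAt_id, ?_⟩
  refine contMDiffAt_clm_of_apply fun u ↦ ?_
  -- The test section is constantly `u` in the trivialization at `x₀`; its image, read in the
  -- trivialization of `E₂`, is the local expression of `A` applied to `u`.
  have h2 := h (fun x ↦ (trivializationAt F₁ E₁ x₀).symm x u) <| by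
    have h3 := (trivializationAt F₁ E₁ x₀).contMDiffOn_symm (IB := 𝓘(ℝ, EB)) (n := ∞)
    have h4 : ContMDiffAt 𝓘(ℝ, EB) (𝓘(ℝ, EB).prod 𝓘(ℝ, F₁)) ∞ (fun x ↦ (x, u)) x₀ :=
      contMDiffAt_id.prodMk contMDiffAt_const
    have hm : (x₀, u) ∈ (trivializationAt F₁ E₁ x₀).target := by
      exact (Trivialization.mem_target _).2 (mem_baseSet_trivializationAt F₁ E₁ x₀)
    refine ((h3.contMDiffAt
      ((trivializationAt F₁ E₁ x₀).open_target.mem_nhds hm)).comp x₀ h4).congr_of_eventuallyEq ?_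
    filter_upwards [(trivializationAt F₁ E₁ x₀).open_baseSet.mem_nhds
      (mem_baseSet_trivializationAt F₁ E₁ x₀)] with x hx
    exact (trivializationAt F₁ E₁ x₀).mk_symm hx u
  refine (contMDiffAt_totalSpace.1 h2).2.congr_of_eventuallyEq ?_
  filter_upwards [(trivializationAt F₂ E₂ x₀).open_baseSet.mem_nhds
    (mem_baseSet_trivializationAt F₂ E₂ x₀),
    (trivializationAt F₁ E₁ x₀).open_baseSet.mem_nhds
    (mem_baseSet_trivializationAt F₁ E₁ x₀)] with x hx hx'
  simp [ContinuousLinearMap.inCoordinates, Trivialization.coe_linearMapAt_of_mem _ hx,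
    Trivialization.symmL_apply _ hx']

end Criterion

section TensorCriterion

variable {E : Type*} [NormedAddCommGroup E] [NormedSpace ℝ E] [FiniteDimensional ℝ E]
  {M : Type*} [TopologicalSpace M] [ChartedSpace E M] [IsManifold 𝓘(ℝ, E) ∞ M]

/-- A field of endomorphisms is smooth if it maps smooth vector fields to smooth vector fields. -/
lemma smoothEndo_of_apply {A : Endo E M}
    (h : ∀ (x₀ : M) (X : VectorField E M),
      ContMDiffAt 𝓘(ℝ, E) 𝓘(ℝ, E).tangent ∞
        (fun x ↦ (⟨x, X x⟩ : TangentBundle 𝓘(ℝ, E) M)) x₀ →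
      ContMDiffAt 𝓘(ℝ, E) 𝓘(ℝ, E).tangent ∞
        (fun x ↦ (⟨x, A x (X x)⟩ : TangentBundle 𝓘(ℝ, E) M)) x₀) : SmoothEndo A :=
  fun x₀ ↦ contMDiffAt_hom_of_apply (F₁ := E) (F₂ := E) (E₁ := TangentSpace 𝓘(ℝ, E))
    (E₂ := TangentSpace 𝓘(ℝ, E)) fun X hX ↦ h x₀ X hX

/-- A bilinear form is smooth if its values on smooth vector fields are smooth functions. -/
lemma smoothBilin_of_apply {B : Bilin E M}
    (h : ∀ (x₀ : M) (X Y : VectorField E M),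
      ContMDiffAt 𝓘(ℝ, E) 𝓘(ℝ, E).tangent ∞
        (fun x ↦ (⟨x, X x⟩ : TangentBundle 𝓘(ℝ, E) M)) x₀ →
      ContMDiffAt 𝓘(ℝ, E) 𝓘(ℝ, E).tangent ∞
        (fun x ↦ (⟨x, Y x⟩ : TangentBundle 𝓘(ℝ, E) M)) x₀ →
      ContMDiffAt 𝓘(ℝ, E) 𝓘(ℝ, ℝ) ∞ (fun x ↦ B x (X x) (Y x)) x₀) : SmoothBilin B := by
  intro x₀
  refine contMDiffAt_hom_of_apply (F₁ := E) (F₂ := E →L[ℝ] ℝ) (E₁ := TangentSpace 𝓘(ℝ, E))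
    (E₂ := fun x : M ↦ TangentSpace 𝓘(ℝ, E) x →L[ℝ] ℝ) fun X hX ↦ ?_
  refine contMDiffAt_hom_of_apply (F₁ := E) (F₂ := ℝ) (E₁ := TangentSpace 𝓘(ℝ, E))
    (E₂ := Bundle.Trivial M ℝ) (A := fun x ↦ B x (X x)) fun Y hY ↦ ?_
  exact contMDiffAt_totalSpace.2 ⟨contMDiffAt_id, h x₀ X Y hX hY⟩

end TensorCriterion

lemma two_le_infty : (2 : WithTop ℕ∞) ≤ ∞ :=
  WithTop.coe_le_coe.2 (le_top : (2 : ℕ∞) ≤ ⊤)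

/-! ### Local parametrizations and vector fields in coordinates -/

section Param

variable {E₁ : Type*} [NormedAddCommGroup E₁] [NormedSpace ℝ E₁]
  {E : Type*} [NormedAddCommGroup E] [NormedSpace ℝ E]
  {M : Type*} [TopologicalSpace M] [ChartedSpace E M]

variable (E₁ E M) in
/-- Local parametrizations of a manifold by open subsets of a normed space. -/
abbrev Param := PartialDiffeomorph 𝓘(ℝ, E₁) 𝓘(ℝ, E) E₁ M ∞

/-- The parametrization inverse to a chart of the maximal atlas. -/
def chartParam (e : OpenPartialHomeomorph M E)
    (he : e ∈ IsManifold.maximalAtlas 𝓘(ℝ, E) ∞ M) : Param E E M where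
  toPartialEquiv := e.toPartialEquiv.symm
  open_source := e.open_target
  open_target := e.open_source
  contMDiffOn_toFun := contMDiffOn_symm_of_mem_maximalAtlas he
  contMDiffOn_invFun := contMDiffOn_of_mem_maximalAtlas he

lemma exists_param [IsManifold 𝓘(ℝ, E) ∞ M] (x : M) :
    ∃ (Φ : Param E E M) (z : E), z ∈ Φ.source ∧ Φ z = x :=
  ⟨chartParam (chartAt E x) (IsManifold.chart_mem_maximalAtlas x), chartAt E x x,
    (chartAt E x).map_source (mem_chart_source E x),
    (chartAt E x).left_inv (mem_chart_source E x)⟩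

namespace Param

variable (Φ : Param E₁ E M) {z : E₁}

lemma contMDiffAt (hz : z ∈ Φ.source) : ContMDiffAt 𝓘(ℝ, E₁) 𝓘(ℝ, E) ∞ Φ z :=
  Φ.contMDiffOn_toFun.contMDiffAt (Φ.open_source.mem_nhds hz)

lemma contMDiffAt_symm {x : M} (hx : x ∈ Φ.target) : ContMDiffAt 𝓘(ℝ, E) 𝓘(ℝ, E₁) ∞ Φ.symm x :=
  Φ.contMDiffOn_invFun.contMDiffAt (Φ.open_target.mem_nhds hx)

lemma mdiffAt (hz : z ∈ Φ.source) : MDifferentiableAt 𝓘(ℝ, E₁) 𝓘(ℝ, E) Φ z :=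
  (Φ.contMDiffAt hz).mdifferentiableAt (by simp)

lemma mdiffAt_symm {x : M} (hx : x ∈ Φ.target) : MDifferentiableAt 𝓘(ℝ, E) 𝓘(ℝ, E₁) Φ.symm x :=
  (Φ.contMDiffAt_symm hx).mdifferentiableAt (by simp)

lemma symm_apply (hz : z ∈ Φ.source) : Φ.symm (Φ z) = z := Φ.left_inv hz

lemma apply_symm {x : M} (hx : x ∈ Φ.target) : Φ (Φ.symm x) = x := Φ.right_inv hx

lemma mfderiv_symm_apply (hz : z ∈ Φ.source) (u : TangentSpace 𝓘(ℝ, E₁) z) :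
    mfderiv 𝓘(ℝ, E) 𝓘(ℝ, E₁) Φ.symm (Φ z) (mfderiv 𝓘(ℝ, E₁) 𝓘(ℝ, E) Φ z u) = u := by
  have h1 := mfderiv_comp z (Φ.mdiffAt_symm (Φ.map_source hz)) (Φ.mdiffAt hz)
  have h2 : Φ.symm ∘ Φ =ᶠ[𝓝 z] id := by
    filter_upwards [Φ.open_source.mem_nhds hz] with y hy using Φ.left_inv hy
  rw [h2.mfderiv_eq, mfderiv_id] at h1
  exact (DFunLike.congr_fun h1 u).symm

lemma mfderiv_apply_symm (hz : z ∈ Φ.source) (v : TangentSpace 𝓘(ℝ, E) (Φ z)) :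
    mfderiv 𝓘(ℝ, E₁) 𝓘(ℝ, E) Φ z (mfderiv 𝓘(ℝ, E) 𝓘(ℝ, E₁) Φ.symm (Φ z) v) = v := by
  have h1 := mfderiv_comp (Φ z) (g := Φ) (by
    rw [Φ.symm_apply hz]; exact Φ.mdiffAt hz) (Φ.mdiffAt_symm (Φ.map_source hz))
  have h2 : Φ ∘ Φ.symm =ᶠ[𝓝 (Φ z)] id := by
    filter_upwards [Φ.open_target.mem_nhds (Φ.map_source hz)] with y hy using Φ.right_inv hy
  rw [h2.mfderiv_eq, mfderiv_id, Φ.symm_apply hz] at h1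
  exact (DFunLike.congr_fun h1 v).symm

/-- The differential of a parametrization, as a continuous linear equivalence. -/
def deriv (hz : z ∈ Φ.source) : TangentSpace 𝓘(ℝ, E₁) z ≃L[ℝ] TangentSpace 𝓘(ℝ, E) (Φ z) :=
  ContinuousLinearEquiv.equivOfInverse (mfderiv 𝓘(ℝ, E₁) 𝓘(ℝ, E) Φ z)
    (mfderiv 𝓘(ℝ, E) 𝓘(ℝ, E₁) Φ.symm (Φ z)) (Φ.mfderiv_symm_apply hz) (Φ.mfderiv_apply_symm hz)

lemma isInvertible_mfderiv (hz : z ∈ Φ.source) :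
    (mfderiv 𝓘(ℝ, E₁) 𝓘(ℝ, E) Φ z).IsInvertible := ⟨Φ.deriv hz, rfl⟩

lemma isInvertible_mfderiv_symm {x : M} (hx : x ∈ Φ.target) :
    (mfderiv 𝓘(ℝ, E) 𝓘(ℝ, E₁) Φ.symm x).IsInvertible := by
  obtain ⟨z, hz, rfl⟩ : ∃ z ∈ Φ.source, Φ z = x := ⟨Φ.symm x, Φ.map_target hx, Φ.right_inv hx⟩
  exact ⟨(Φ.deriv hz).symm, rfl⟩

lemma inverse_mfderiv (hz : z ∈ Φ.source) :
    (mfderiv 𝓘(ℝ, E₁) 𝓘(ℝ, E) Φ z).inverse = mfderiv 𝓘(ℝ, E) 𝓘(ℝ, E₁) Φ.symm (Φ z) :=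
  ContinuousLinearMap.inverse_equiv (Φ.deriv hz)

/-- The expression of a vector field in a parametrization. -/
def coordField (X : VectorField E M) : E₁ → E₁ := mpullback 𝓘(ℝ, E₁) 𝓘(ℝ, E) Φ X

/-- The vector field with a given expression in a parametrization. -/
def pushField (Z : E₁ → E₁) : VectorField E M := mpullback 𝓘(ℝ, E) 𝓘(ℝ, E₁) Φ.symm Z

lemma mfderiv_coordField (hz : z ∈ Φ.source) (X : VectorField E M) :
    mfderiv 𝓘(ℝ, E₁) 𝓘(ℝ, E) Φ z (Φ.coordField X z) = X (Φ z) := by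
  refine Eq.trans (congrArg _ ?_) (Φ.mfderiv_apply_symm hz (X (Φ z)))
  exact DFunLike.congr_fun (Φ.inverse_mfderiv hz) (X (Φ z))

lemma coordField_eq_iff (hz : z ∈ Φ.source) (X : VectorField E M) (u : E₁) :
    Φ.coordField X z = u ↔ X (Φ z) = mfderiv 𝓘(ℝ, E₁) 𝓘(ℝ, E) Φ z u := by
  rw [← Φ.mfderiv_coordField hz X]
  exact (Φ.deriv hz).injective.eq_iff.symm

lemma pushField_apply (hz : z ∈ Φ.source) (Z : E₁ → E₁) :
    Φ.pushField Z (Φ z) = mfderiv 𝓘(ℝ, E₁) 𝓘(ℝ, E) Φ z (Z z) := by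
  have : (mfderiv 𝓘(ℝ, E) 𝓘(ℝ, E₁) Φ.symm (Φ z)).inverse = mfderiv 𝓘(ℝ, E₁) 𝓘(ℝ, E) Φ z :=
    ContinuousLinearMap.inverse_equiv (Φ.deriv hz).symm
  refine (DFunLike.congr_fun this _).trans ?_
  exact congrArg (fun y ↦ mfderiv 𝓘(ℝ, E₁) 𝓘(ℝ, E) Φ z (Z y)) (Φ.symm_apply hz)

lemma coordField_pushField (hz : z ∈ Φ.source) (Z : E₁ → E₁) :
    Φ.coordField (Φ.pushField Z) z = Z z :=
  (Φ.coordField_eq_iff hz _ _).2 (Φ.pushField_apply hz Z)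

variable [IsManifold 𝓘(ℝ, E) ∞ M]

lemma contDiffAt_coordField [CompleteSpace E₁] (hz : z ∈ Φ.source) {X : VectorField E M}
    (hX : ContMDiffAt 𝓘(ℝ, E) 𝓘(ℝ, E).tangent ∞
      (fun x ↦ (⟨x, X x⟩ : TangentBundle 𝓘(ℝ, E) M)) (Φ z)) :
    ContDiffAt ℝ ∞ (Φ.coordField X) z :=
  contMDiffAt_vectorSpace_iff_contDiffAt.1 <|
    ContMDiffAt.mpullback_vectorField_preimage hX (Φ.contMDiffAt hz)
      (Φ.isInvertible_mfderiv hz) le_rfl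

lemma smoothVF_pushField [CompleteSpace E] {Z : E₁ → E₁}
    (hZ : ContDiffOn ℝ ∞ Z Φ.source) : SmoothVF (Φ.pushField Z) Φ.target := by
  intro x hx
  refine ContMDiffAt.contMDiffWithinAt ?_
  refine ContMDiffAt.mpullback_vectorField_preimage (V := Z) ?_ (Φ.contMDiffAt_symm hx)
      (Φ.isInvertible_mfderiv_symm hx) le_rfl
  exact contMDiffAt_vectorSpace_iff_contDiffAt.2
    (hZ.contDiffAt (Φ.open_source.mem_nhds (Φ.map_target hx)))

/-- Brackets are natural under local diffeomorphisms, and on a normed space the bracket is `DY X -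
DX Y`. -/
lemma mfderiv_lieBracket [CompleteSpace E] [CompleteSpace E₁] (hz : z ∈ Φ.source)
    {X Y : VectorField E M}
    (hX : ContMDiffAt 𝓘(ℝ, E) 𝓘(ℝ, E).tangent ∞
      (fun x ↦ (⟨x, X x⟩ : TangentBundle 𝓘(ℝ, E) M)) (Φ z))
    (hY : ContMDiffAt 𝓘(ℝ, E) 𝓘(ℝ, E).tangent ∞
      (fun x ↦ (⟨x, Y x⟩ : TangentBundle 𝓘(ℝ, E) M)) (Φ z)) :
    bracket X Y (Φ z) = mfderiv 𝓘(ℝ, E₁) 𝓘(ℝ, E) Φ z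
      (fderiv ℝ (Φ.coordField Y) z (Φ.coordField X z)
        - fderiv ℝ (Φ.coordField X) z (Φ.coordField Y z)) := by
  have : IsManifold 𝓘(ℝ, E) (minSmoothness ℝ 2) M := .of_le (n := ∞) (by simpa using two_le_infty)
  have h := mpullback_mlieBracket (I := 𝓘(ℝ, E₁)) (hX.mdifferentiableAt (by simp))
    (hY.mdifferentiableAt (by simp)) (Φ.contMDiffAt hz) (by simpa using two_le_infty)
  rw [← Φ.mfderiv_coordField hz (bracket X Y)]
  refine congrArg _ (h.trans ?_)
  rw [← mlieBracketWithin_univ, mlieBracketWithin_eq_lieBracketWithin]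
  exact congrFun (lieBracketWithin_univ (𝕜 := ℝ) (V := Φ.coordField X) (W := Φ.coordField Y)) z

lemma dirDeriv_apply (hz : z ∈ Φ.source) {f : M → ℝ}
    (hf : MDifferentiableAt 𝓘(ℝ, E) 𝓘(ℝ, ℝ) f (Φ z)) (u : E₁) :
    dirDeriv f (Φ z) (mfderiv 𝓘(ℝ, E₁) 𝓘(ℝ, E) Φ z u) = fderiv ℝ (f ∘ Φ) z u := by
  rw [← mfderiv_eq_fderiv, mfderiv_comp z hf (Φ.mdiffAt hz)]
  rfl

end Param

end Param

/-! ### Forms, endomorphisms, `d` and the Nijenhuis tensor in coordinates -/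

section CoordTensors

variable {E₁ : Type*} [NormedAddCommGroup E₁] [NormedSpace ℝ E₁] [FiniteDimensional ℝ E₁]
  {E : Type*} [NormedAddCommGroup E] [NormedSpace ℝ E] [FiniteDimensional ℝ E]
  {M : Type*} [TopologicalSpace M] [ChartedSpace E M]

/-- The pullback of a bilinear form to a normed space. -/
def coordBilin (f : E₁ → M) (B : Bilin E M) : E₁ → E₁ →L[ℝ] E₁ →L[ℝ] ℝ := pullback E₁ f B

lemma coordBilin_apply (f : E₁ → M) (B : Bilin E M) (z u v : E₁) :
    coordBilin f B z u v
      = B (f z) (mfderiv 𝓘(ℝ, E₁) 𝓘(ℝ, E) f z u) (mfderiv 𝓘(ℝ, E₁) 𝓘(ℝ, E) f z v) := rfl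

/-- The expression of a field of endomorphisms in a parametrization. -/
def Param.coordEndo (Φ : Param E₁ E M) (A : Endo E M) : E₁ → E₁ →L[ℝ] E₁ := fun z ↦
  (mfderiv 𝓘(ℝ, E) 𝓘(ℝ, E₁) Φ.symm (Φ z)) ∘L A (Φ z) ∘L mfderiv 𝓘(ℝ, E₁) 𝓘(ℝ, E) Φ z

variable (Φ : Param E₁ E M) {z : E₁}

lemma Param.mfderiv_coordEndo (hz : z ∈ Φ.source) (A : Endo E M) (u : E₁) :
    mfderiv 𝓘(ℝ, E₁) 𝓘(ℝ, E) Φ z (Φ.coordEndo A z u)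
      = A (Φ z) (mfderiv 𝓘(ℝ, E₁) 𝓘(ℝ, E) Φ z u) :=
  Φ.mfderiv_apply_symm hz _

lemma Param.coordField_evalEndo (hz : z ∈ Φ.source) (A : Endo E M) (X : VectorField E M) :
    Φ.coordField (evalEndo A X) z = Φ.coordEndo A z (Φ.coordField X z) := by
  rw [Φ.coordField_eq_iff hz, Φ.mfderiv_coordEndo hz, Φ.mfderiv_coordField hz]

lemma Param.coordBilin_coordField (hz : z ∈ Φ.source) (B : Bilin E M) (X Y : VectorField E M) :
    coordBilin Φ B z (Φ.coordField X z) (Φ.coordField Y z) = evalBilin B X Y (Φ z) := by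
  rw [coordBilin_apply, Φ.mfderiv_coordField hz, Φ.mfderiv_coordField hz]

variable [IsManifold 𝓘(ℝ, E) ∞ M]

lemma contDiffAt_coordBilin {f : E₁ → M} {B : Bilin E M} (hB : SmoothBilin B)
    (hf : ContMDiffAt 𝓘(ℝ, E₁) 𝓘(ℝ, E) ∞ f z) : ContDiffAt ℝ ∞ (coordBilin f B) z :=
  contDiffAt_clm_of_apply fun u ↦ contDiffAt_clm_of_apply fun v ↦
    (hB.contMDiffAt_apply (contMDiffAt_mfderiv_const u hf)
      (contMDiffAt_mfderiv_const v hf)).contDiffAt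

lemma Param.contDiffAt_coordEndo {A : Endo E M} (hA : SmoothEndo A) (hz : z ∈ Φ.source) :
    ContDiffAt ℝ ∞ (Φ.coordEndo A) z := by
  refine contDiffAt_clm_of_apply fun u ↦ ?_
  have h := hA.contMDiffAt_apply (contMDiffAt_mfderiv_const u (Φ.contMDiffAt hz))
  have h2 : ContMDiffAt 𝓘(ℝ, E) 𝓘(ℝ, E).tangent ∞
      (fun x ↦ (⟨x, A x (Φ.pushField (fun _ ↦ u) x)⟩ : TangentBundle 𝓘(ℝ, E) M)) (Φ z) :=
    hA.contMDiffAt_apply ((Φ.smoothVF_pushField contDiffOn_const).contMDiffAt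
      (Φ.open_target.mem_nhds (Φ.map_source hz)))
  refine (Φ.contDiffAt_coordField hz h2).congr_of_eventuallyEq ?_
  filter_upwards [Φ.open_source.mem_nhds hz] with y hy
  have := Φ.coordField_evalEndo hy A (Φ.pushField fun _ ↦ u)
  rw [Φ.coordField_pushField hy] at this
  exact this.symm

/-- The exterior derivative of the expression of a form. -/
def extDerivative (b : E₁ → E₁ →L[ℝ] E₁ →L[ℝ] ℝ) (z u v w : E₁) : ℝ :=
  fderiv ℝ b z u v w - fderiv ℝ b z v u w + fderiv ℝ b z w u v

lemma SmoothBilin.mdifferentiableAt_evalBilin {B : Bilin E M} (hB : SmoothBilin B) {x : M}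
    {X Y : VectorField E M}
    (hX : ContMDiffAt 𝓘(ℝ, E) 𝓘(ℝ, E).tangent ∞
      (fun x ↦ (⟨x, X x⟩ : TangentBundle 𝓘(ℝ, E) M)) x)
    (hY : ContMDiffAt 𝓘(ℝ, E) 𝓘(ℝ, E).tangent ∞
      (fun x ↦ (⟨x, Y x⟩ : TangentBundle 𝓘(ℝ, E) M)) x) :
    MDifferentiableAt 𝓘(ℝ, E) 𝓘(ℝ, ℝ) (evalBilin B X Y) x :=
  (hB.contMDiffAt_apply hX hY).mdifferentiableAt (by simp)

lemma Param.dirDeriv_evalBilin {B : Bilin E M} (hB : SmoothBilin B) (hz : z ∈ Φ.source)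
    {X Y : VectorField E M}
    (hX : ContMDiffAt 𝓘(ℝ, E) 𝓘(ℝ, E).tangent ∞
      (fun x ↦ (⟨x, X x⟩ : TangentBundle 𝓘(ℝ, E) M)) (Φ z))
    (hY : ContMDiffAt 𝓘(ℝ, E) 𝓘(ℝ, E).tangent ∞
      (fun x ↦ (⟨x, Y x⟩ : TangentBundle 𝓘(ℝ, E) M)) (Φ z)) (u : E₁) :
    dirDeriv (evalBilin B X Y) (Φ z) (mfderiv 𝓘(ℝ, E₁) 𝓘(ℝ, E) Φ z u)
      = fderiv ℝ (coordBilin Φ B) z u (Φ.coordField X z) (Φ.coordField Y z)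
        + coordBilin Φ B z (fderiv ℝ (Φ.coordField X) z u) (Φ.coordField Y z)
        + coordBilin Φ B z (Φ.coordField X z) (fderiv ℝ (Φ.coordField Y) z u) := by
  rw [Φ.dirDeriv_apply hz (hB.mdifferentiableAt_evalBilin hX hY)]
  have h1 : (evalBilin B X Y) ∘ Φ =ᶠ[𝓝 z]
      fun y ↦ coordBilin Φ B y (Φ.coordField X y) (Φ.coordField Y y) := by
    filter_upwards [Φ.open_source.mem_nhds hz] with y hy
    exact (Φ.coordBilin_coordField hy B X Y).symm
  have hb := ((contDiffAt_coordBilin hB (Φ.contMDiffAt hz)).differentiableAt (by simp)).hasFDerivAt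
  have hx := ((Φ.contDiffAt_coordField hz hX).differentiableAt (by simp)).hasFDerivAt
  have hy := ((Φ.contDiffAt_coordField hz hY).differentiableAt (by simp)).hasFDerivAt
  rw [h1.fderiv_eq, ((hb.clm_apply hx).clm_apply hy).fderiv]
  simp
  ring

lemma SmoothVF.contMDiffAt {X : VectorField E M} {U : Set M} (hX : SmoothVF X U) (hU : IsOpen U)
    {x : M} (hx : x ∈ U) : ContMDiffAt 𝓘(ℝ, E) 𝓘(ℝ, E).tangent ∞
      (fun x ↦ (⟨x, X x⟩ : TangentBundle 𝓘(ℝ, E) M)) x :=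
  ContMDiffOn.contMDiffAt hX (hU.mem_nhds hx)

lemma Param.fderiv_coordField_pushField_const (hz : z ∈ Φ.source) (u : E₁) :
    fderiv ℝ (Φ.coordField (Φ.pushField fun _ ↦ u)) z = 0 := by
  have : Φ.coordField (Φ.pushField fun _ ↦ u) =ᶠ[𝓝 z] fun _ ↦ u := by
    filter_upwards [Φ.open_source.mem_nhds hz] with y hy
    exact Φ.coordField_pushField hy _
  rw [this.fderiv_eq]
  simp

/-- Fields constant in the parametrization have zero brackets and zero coordinate derivatives, so
the invariant formula for `dB` leaves only derivatives of the components of `B`. -/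
lemma IsClosedForm.extDerivative_coordBilin {B : Bilin E M} (h : IsClosedForm B)
    (hB : SmoothBilin B) (hz : z ∈ Φ.source) (u v w : E₁) :
    extDerivative (coordBilin Φ B) z u v w = 0 := by
  have hs : ∀ u, SmoothVF (Φ.pushField fun _ ↦ u) Φ.target := fun u ↦
    Φ.smoothVF_pushField contDiffOn_const
  have hp := Φ.map_source hz
  have hs' := fun u ↦ (hs u).contMDiffAt Φ.open_target hp
  have hc : ∀ u, (Φ.coordField (Φ.pushField fun _ ↦ u)) z = u := fun u ↦
    Φ.coordField_pushField hz _
  have key := h _ Φ.open_target _ _ _ (hs u) (hs v) (hs w) _ hp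
  have e : ∀ u v, bracket (Φ.pushField fun _ ↦ u) (Φ.pushField fun _ ↦ v) (Φ z) = 0 := fun u v ↦ by
    rw [Φ.mfderiv_lieBracket hz (hs' u) (hs' v), Φ.fderiv_coordField_pushField_const hz,
      Φ.fderiv_coordField_pushField_const hz]
    exact (congrArg (mfderiv 𝓘(ℝ, E₁) 𝓘(ℝ, E) Φ z) (sub_self (0 : E₁))).trans (map_zero _)
  rw [e, e, e, Φ.pushField_apply hz, Φ.pushField_apply hz, Φ.pushField_apply hz,
    Φ.dirDeriv_evalBilin hB hz (hs' _) (hs' _), Φ.dirDeriv_evalBilin hB hz (hs' _) (hs' _),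
    Φ.dirDeriv_evalBilin hB hz (hs' _) (hs' _)] at key
  simp only [Φ.fderiv_coordField_pushField_const hz, hc] at key
  simpa [extDerivative] using key

/-- By skewness the derivatives of the three fields cancel against the bracket terms. Only
`extDerivative` at their values remains, so one parametrization around each point is enough. -/
lemma isClosedForm_of_extDerivative {B : Bilin E M} (hB : SmoothBilin B)
    (halt : ∀ x v w, B x v w = - B x w v)
    (h : ∀ x : M, ∃ (Φ : Param E E M) (z : E), z ∈ Φ.source ∧ Φ z = x ∧
      ∀ u v w, extDerivative (coordBilin Φ B) z u v w = 0) : IsClosedForm B := by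
  intro U hU X Y Z hX hY hZ x hx
  obtain ⟨Φ, z, hz, rfl, hd⟩ := h x
  replace hX := hX.contMDiffAt hU hx
  replace hY := hY.contMDiffAt hU hx
  replace hZ := hZ.contMDiffAt hU hx
  rw [Φ.mfderiv_lieBracket hz hX hY, Φ.mfderiv_lieBracket hz hX hZ, Φ.mfderiv_lieBracket hz hY hZ,
    ← Φ.mfderiv_coordField hz X, ← Φ.mfderiv_coordField hz Y, ← Φ.mfderiv_coordField hz Z,
    Φ.dirDeriv_evalBilin hB hz hX hY, Φ.dirDeriv_evalBilin hB hz hX hZ,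
    Φ.dirDeriv_evalBilin hB hz hY hZ, ← coordBilin_apply, ← coordBilin_apply, ← coordBilin_apply]
  have hd' := hd (Φ.coordField X z) (Φ.coordField Y z) (Φ.coordField Z z)
  have ha : ∀ u v, coordBilin Φ B z u v = - coordBilin Φ B z v u := fun u v ↦ halt _ _ _
  simp only [extDerivative] at hd'
  simp only [map_sub, _root_.sub_apply]
  rw [ha (Φ.coordField Y z) (fderiv ℝ (Φ.coordField Z) z (Φ.coordField X z)),
    ha (Φ.coordField X z) (fderiv ℝ (Φ.coordField Z) z (Φ.coordField Y z)),
    ha (Φ.coordField X z) (fderiv ℝ (Φ.coordField Y) z (Φ.coordField Z z))]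
  linarith

/-- The Nijenhuis tensor of the expression of a field of endomorphisms. -/
def coordNijenhuis (J : E₁ → E₁ →L[ℝ] E₁) (z u v : E₁) : E₁ :=
  fderiv ℝ J z (J z u) v - fderiv ℝ J z (J z v) u + J z (fderiv ℝ J z v u)
    - J z (fderiv ℝ J z u v)

/-- This is the tensoriality of the Nijenhuis expression: the derivatives of `X` and `Y` drop out
and only `DJ` survives. -/
lemma Param.nijenhuis_eq {J : Endo E M} (hJ : SmoothEndo J) (hz : z ∈ Φ.source)
    {X Y : VectorField E M}
    (hX : ContMDiffAt 𝓘(ℝ, E) 𝓘(ℝ, E).tangent ∞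
      (fun x ↦ (⟨x, X x⟩ : TangentBundle 𝓘(ℝ, E) M)) (Φ z))
    (hY : ContMDiffAt 𝓘(ℝ, E) 𝓘(ℝ, E).tangent ∞
      (fun x ↦ (⟨x, Y x⟩ : TangentBundle 𝓘(ℝ, E) M)) (Φ z)) :
    bracket (evalEndo J X) (evalEndo J Y) (Φ z) - J (Φ z) (bracket (evalEndo J X) Y (Φ z))
      - J (Φ z) (bracket X (evalEndo J Y) (Φ z)) + J (Φ z) (J (Φ z) (bracket X Y (Φ z)))
      = mfderiv 𝓘(ℝ, E₁) 𝓘(ℝ, E) Φ z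
        (coordNijenhuis (E₁ := E₁) (Φ.coordEndo J) z (Φ.coordField X z) (Φ.coordField Y z)) := by
  have hJX := hJ.contMDiffAt_apply hX
  have hJY := hJ.contMDiffAt_apply hY
  have hj := ((Φ.contDiffAt_coordEndo hJ hz).differentiableAt (by simp)).hasFDerivAt
  have hx := ((Φ.contDiffAt_coordField hz hX).differentiableAt (by simp)).hasFDerivAt
  have hy := ((Φ.contDiffAt_coordField hz hY).differentiableAt (by simp)).hasFDerivAt
  have e : ∀ X : VectorField E M, Φ.coordField (evalEndo J X) =ᶠ[𝓝 z]
      fun y ↦ Φ.coordEndo J y (Φ.coordField X y) := fun X ↦ by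
    filter_upwards [Φ.open_source.mem_nhds hz] with y hy
    exact Φ.coordField_evalEndo hy J X
  rw [Φ.mfderiv_lieBracket hz hJX hJY, Φ.mfderiv_lieBracket hz hJX hY,
    Φ.mfderiv_lieBracket hz hX hJY, Φ.mfderiv_lieBracket hz hX hY,
    (e X).fderiv_eq, (e Y).fderiv_eq, (e X).eq_of_nhds, (e Y).eq_of_nhds,
    (hj.clm_apply hx).fderiv, (hj.clm_apply hy).fderiv, ← Φ.mfderiv_coordEndo hz,
    ← Φ.mfderiv_coordEndo hz, ← Φ.mfderiv_coordEndo hz, ← Φ.mfderiv_coordEndo hz]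
  have hlin : ∀ (L : E₁ →L[ℝ] E) (a b c d : E₁), L a - L b - L c + L d = L (a - b - c + d) := by
    simp
  refine (hlin (mfderiv 𝓘(ℝ, E₁) 𝓘(ℝ, E) Φ z) _ _ _ _).trans (congrArg _ ?_)
  -- The cancellation is pure algebra, valid for arbitrary linear maps in place of the derivatives
  -- of `J`, `X` and `Y`.
  have hpure : ∀ (j : E₁ →L[ℝ] E₁) (dj : E₁ →L[ℝ] E₁ →L[ℝ] E₁) (dx dy : E₁ →L[ℝ] E₁) (x y : E₁),
      ((j ∘L dy + dj.flip y) (j x) - (j ∘L dx + dj.flip x) (j y))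
        - j (dy (j x) - (j ∘L dx + dj.flip x) y) - j ((j ∘L dy + dj.flip y) x - dx (j y))
        + j (j (dy x - dx y)) = dj (j x) y - dj (j y) x + j (dj y x) - j (dj x y) := by
    intros
    simp
    abel
  exact hpure _ _ _ _ _ _

lemma NijenhuisVanishes.coordNijenhuis {J : Endo E M} (h : NijenhuisVanishes J)
    (hJ : SmoothEndo J) (hz : z ∈ Φ.source) (u v : E₁) :
    coordNijenhuis (Φ.coordEndo J) z u v = 0 := by
  have hs : ∀ u, SmoothVF (Φ.pushField fun _ ↦ u) Φ.target := fun u ↦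
    Φ.smoothVF_pushField contDiffOn_const
  have hp := Φ.map_source hz
  have hs' := fun u ↦ (hs u).contMDiffAt Φ.open_target hp
  have hc : ∀ u, (Φ.coordField (Φ.pushField fun _ ↦ u)) z = u := fun u ↦
    Φ.coordField_pushField hz _
  have key := h _ Φ.open_target _ _ (hs u) (hs v) _ hp
  rw [Φ.nijenhuis_eq hJ hz (hs' u) (hs' v), hc, hc] at key
  exact (Φ.deriv hz).injective (key.trans (map_zero _).symm)

lemma nijenhuisVanishes_of_coordNijenhuis {J : Endo E M} (hJ : SmoothEndo J)
    (h : ∀ x : M, ∃ (Φ : Param E E M) (z : E), z ∈ Φ.source ∧ Φ z = x ∧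
      ∀ u v, SymplecticReduction.coordNijenhuis (Φ.coordEndo J) z u v = 0) :
    NijenhuisVanishes J := by
  intro U hU X Y hX hY x hx
  obtain ⟨Φ, z, hz, rfl, hd⟩ := h x
  rw [Φ.nijenhuis_eq hJ hz (hX.contMDiffAt hU hx) (hY.contMDiffAt hU hx), hd]
  exact map_zero _

end CoordTensors

/-! ### Pullback of `d` and descent of the Nijenhuis tensor, in normed spaces -/

section NormedCalculus

variable {E E' E'' : Type*} [NormedAddCommGroup E] [NormedSpace ℝ E] [NormedAddCommGroup E']
  [NormedSpace ℝ E'] [NormedAddCommGroup E''] [NormedSpace ℝ E'']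

lemma hasFDerivAt_comp_fderiv {G : Type*} [NormedAddCommGroup G] [NormedSpace ℝ G] {b : E → G}
    {f : E' → E} {f' : E' →L[ℝ] E} {z : E'} (hb : DifferentiableAt ℝ b (f z))
    (hf : HasFDerivAt f f' z) : HasFDerivAt (fun y ↦ b (f y)) (fderiv ℝ b (f z) ∘L f') z :=
  hb.hasFDerivAt.comp z hf

/-- The exterior derivative of a `2`-form commutes with pullback. -/
lemma extDerivative_pullback [FiniteDimensional ℝ E'] {b : E → E →L[ℝ] E →L[ℝ] ℝ}
    {b' : E' → E' →L[ℝ] E' →L[ℝ] ℝ} {f : E' → E} {z : E'} (hf : ContDiffAt ℝ ∞ f z)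
    (hb : DifferentiableAt ℝ b (f z)) (halt : ∀ x y, b (f z) x y = - b (f z) y x)
    (hbb : ∀ᶠ y in 𝓝 z, ∀ u v, b' y u v = b (f y) (fderiv ℝ f y u) (fderiv ℝ f y v))
    (hb' : DifferentiableAt ℝ b' z)
    (hd : ∀ x y w, fderiv ℝ b (f z) x y w - fderiv ℝ b (f z) y x w + fderiv ℝ b (f z) w x y = 0)
    (u v w : E') : extDerivative b' z u v w = 0 := by
  have hf1 := (hf.differentiableAt (by simp)).hasFDerivAt
  have hf2 : HasFDerivAt (fderiv ℝ f) (fderiv ℝ (fderiv ℝ f) z) z :=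
    ((hf.fderiv_right (m := ∞) (by simp)).differentiableAt (by simp)).hasFDerivAt
  have hsymm : IsSymmSndFDerivAt ℝ f z := hf.isSymmSndFDerivAt (by simpa using two_le_infty)
  have key : ∀ u v w, fderiv ℝ b' z u v w
      = fderiv ℝ b (f z) (fderiv ℝ f z u) (fderiv ℝ f z v) (fderiv ℝ f z w)
        + b (f z) (fderiv ℝ (fderiv ℝ f) z u v) (fderiv ℝ f z w)
        + b (f z) (fderiv ℝ f z v) (fderiv ℝ (fderiv ℝ f) z u w) := by
    intro u v w
    have h1 : (fun y ↦ b' y v w) =ᶠ[𝓝 z] fun y ↦ b (f y) (fderiv ℝ f y v) (fderiv ℝ f y w) := by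
      filter_upwards [hbb] with y hy using hy v w
    have h2 : HasFDerivAt (fun y ↦ b' y v w) ((fderiv ℝ b' z).flip v |>.flip w) z := by
      have := (hb'.hasFDerivAt.clm_apply (hasFDerivAt_const v z)).clm_apply (hasFDerivAt_const w z)
      refine this.congr_fderiv ?_
      ext
      simp
    have h0 := hasFDerivAt_comp_fderiv (G := E →L[ℝ] E →L[ℝ] ℝ) hb hf1
    have h3 := (HasFDerivAt.clm_apply (G := E) (H := E →L[ℝ] ℝ) h0
      (hf2.clm_apply (hasFDerivAt_const v z))).clm_apply (hf2.clm_apply (hasFDerivAt_const w z))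
    have h4 := DFunLike.congr_fun (h2.unique (h3.congr_of_eventuallyEq h1)) u
    simp only [ContinuousLinearMap.flip_apply, _root_.add_apply, ContinuousLinearMap.comp_apply,
      _root_.zero_apply, map_zero, zero_add] at h4
    rw [h4]
    ring
  have h := hd (fderiv ℝ f z u) (fderiv ℝ f z v) (fderiv ℝ f z w)
  -- The six terms with second derivatives of `f` cancel in pairs: two pairs by symmetry of `D²f`,
  -- the third by skewness of `b` as well.
  rw [extDerivative, key, key, key, hsymm v u, hsymm w u, hsymm w v,
    halt (fderiv ℝ f z v) (fderiv ℝ (fderiv ℝ f) z u w)]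
  linarith

/-- The Nijenhuis tensor descends along a horizontal lift `H` of a linear projection `pr`, when
`ι` is a map such that `J ∘ dι ∘ H = dι ∘ H ∘ J'` and the image of `dι ∘ H` is a non degenerate
subspace orthogonal to the image of the kernel of `pr`. -/
lemma coordNijenhuis_descend [FiniteDimensional ℝ E''] [FiniteDimensional ℝ E'] {ι : E' → E}
    {c : E'} {pr : E' →L[ℝ] E''}
    {H : E' → E'' →L[ℝ] E'} {J : E → E →L[ℝ] E} {J' : E'' → E'' →L[ℝ] E''}
    {γ : E →L[ℝ] E →L[ℝ] ℝ} {ε : ℝ}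
    (hι : ContDiffAt ℝ ∞ ι c) (hH : DifferentiableAt ℝ H c) (hJ : DifferentiableAt ℝ J (ι c))
    (hJ' : DifferentiableAt ℝ J' (pr c))
    (hpr : ∀ᶠ y in 𝓝 c, ∀ u, pr (H y u) = u)
    (hJJ : ∀ᶠ y in 𝓝 c, ∀ u, J (ι y) (fderiv ℝ ι y (H y u)) = fderiv ℝ ι y (H y (J' (pr y) u)))
    (hγK : ∀ k, pr k = 0 → ∀ u, γ (fderiv ℝ ι c k) (fderiv ℝ ι c (H c u)) = 0)
    (hγJ : ∀ x y, γ (J (ι c) x) y = ε * γ x (J (ι c) y))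
    (hnd : ∀ u, (∀ u', γ (fderiv ℝ ι c (H c u)) (fderiv ℝ ι c (H c u')) = 0) → u = 0)
    (hN : ∀ x y, fderiv ℝ J (ι c) (J (ι c) x) y - fderiv ℝ J (ι c) (J (ι c) y) x
      + J (ι c) (fderiv ℝ J (ι c) y x) - J (ι c) (fderiv ℝ J (ι c) x y) = 0) (a b : E'') :
    coordNijenhuis J' (pr c) a b = 0 := by
  set j := J (ι c)
  set dj := fderiv ℝ J (ι c)
  set j' := J' (pr c)
  set dj' := fderiv ℝ J' (pr c)
  set A := fderiv ℝ ι c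
  set A' := fderiv ℝ (fderiv ℝ ι) c
  set h := H c
  set h' := fderiv ℝ H c
  have hι1 : HasFDerivAt ι A c := (hι.differentiableAt (by simp)).hasFDerivAt
  have hι2 : HasFDerivAt (fderiv ℝ ι) A' c :=
    ((hι.fderiv_right (m := ∞) (by simp)).differentiableAt (by simp)).hasFDerivAt
  have hsymm : ∀ u v, A' u v = A' v u := hι.isSymmSndFDerivAt (by simpa using two_le_infty)
  have hh : HasFDerivAt H h' c := hH.hasFDerivAt
  -- the derivative of `dι ∘ H`
  let L' : E' → E'' → E := fun k u ↦ A' k (h u) + A (h' k u)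
  have hL : ∀ u, HasFDerivAt (fun y ↦ fderiv ℝ ι y (H y u)) (A'.flip (h u) + A ∘L h'.flip u) c := by
    intro u
    have := hι2.clm_apply (hh.clm_apply (hasFDerivAt_const u c))
    refine this.congr_fderiv ?_
    ext k
    simp [A, h]
    abel
  have hpr0 := hpr.self_of_nhds
  -- Differentiating `pr (H y u) = u` shows that the derivative of a lift is vertical.
  have hpr' : ∀ k u, pr (h' k u) = 0 := by
    intro k u
    have h1 : HasFDerivAt (fun y ↦ pr (H y u)) (pr ∘L h'.flip u) c := by
      have := pr.hasFDerivAt.comp c (hh.clm_apply (hasFDerivAt_const u c))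
      refine this.congr_fderiv ?_
      ext k
      simp
    have h2 : (fun y ↦ pr (H y u)) =ᶠ[𝓝 c] fun _ ↦ u := by
      filter_upwards [hpr] with y hy using hy u
    exact DFunLike.congr_fun (h1.unique ((hasFDerivAt_const u c).congr_of_eventuallyEq h2)) k
  have hJJ0 : ∀ u, j (A (h u)) = A (h (j' u)) := hJJ.self_of_nhds
  -- The intertwining relation `hJJ` differentiated along `k`; it trades the derivative of `J` on
  -- lifted vectors for that of `J'`.
  have R : ∀ k u, dj (A k) (A (h u)) + j (L' k u) = L' k (j' u) + A (h (dj' (pr k) u)) := by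
    intro k u
    have h0 : HasFDerivAt (fun y ↦ J (ι y)) (dj ∘L A) c := hJ.hasFDerivAt.comp c hι1
    have h1 := h0.clm_apply (hL u)
    have h2 : HasFDerivAt (fun y ↦ H y (J' (pr y) u)) (h ∘L (dj' ∘L pr).flip u
        + h'.flip (j' u)) c := by
      have h0 : HasFDerivAt (fun y ↦ J' (pr y)) (dj' ∘L pr) c :=
        hJ'.hasFDerivAt.comp c pr.hasFDerivAt
      have := hh.clm_apply (h0.clm_apply (hasFDerivAt_const u c))
      refine this.congr_fderiv ?_
      ext k
      simp [j', h, dj']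
    have h3 := hι2.clm_apply h2
    have h4 : (fun y ↦ J (ι y) (fderiv ℝ ι y (H y u))) =ᶠ[𝓝 c]
        fun y ↦ fderiv ℝ ι y (H y (J' (pr y) u)) := by
      filter_upwards [hJJ] with y hy using hy u
    have h5 : j (A' k (h u) + A (h' k u)) + dj (A k) (A (h u))
        = A (h (dj' (pr k) u) + h' k (j' u)) + A' k (h (j' u)) :=
      DFunLike.congr_fun (h1.unique (h3.congr_of_eventuallyEq h4)) k
    rw [add_comm, h5, map_add]
    simp only [L']
    abel
  -- antisymmetrisations lie in the image of the kernel of `pr`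
  have hT : ∀ u v, ∃ k, pr k = 0 ∧ L' (h u) v - L' (h v) u = A k := by
    intro u v
    refine ⟨h' (h u) v - h' (h v) u, by simp [hpr'], ?_⟩
    simp only [L', hsymm (h u) (h v), map_sub]
    abel
  -- `T u v` is the image under `dι` of the bracket of the lifts of the constant fields `u` and `v`:
  -- the second derivatives of `ι` cancel by symmetry.
  let T : E'' → E'' → E := fun u v ↦ L' (h u) v - L' (h v) u
  have hγT : ∀ u v w, γ (T u v) (A (h w)) = 0 := by
    intro u v w
    obtain ⟨k, hk, hk'⟩ := hT u v
    simp only [T, hk', hγK k hk w]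
  -- `j` moves across `γ` up to the factor `ε` and preserves lifted vectors, so orthogonality
  -- persists even where `j (T u v)` is not in the image of `dι`.
  have hγJT : ∀ u v w, γ (j (T u v)) (A (h w)) = 0 := by
    intro u v w
    rw [hγJ, hJJ0, hγT, mul_zero]
  have hγJJT : ∀ u v w, γ (j (j (T u v))) (A (h w)) = 0 := by
    intro u v w
    rw [hγJ, hJJ0, hγJT, mul_zero]
  -- The vanishing Nijenhuis expression of `J` at the lifts of `a` and `b`, with each derivative of
  -- `J` rewritten through `R`.
  have hsum : A (h (coordNijenhuis J' (pr c) a b)) + T (j' a) (j' b) - j (T (j' a) b)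
      + j (T (j' b) a) - j (j (T b a)) = 0 := by
    have h1 := R (h (j' a)) b
    have h2 := R (h (j' b)) a
    have h3 := R (h b) a
    have h4 := R (h a) b
    have hN' := hN (A (h a)) (A (h b))
    rw [hJJ0, hJJ0] at hN'
    rw [hpr0] at h1 h2 h3 h4
    rw [← eq_sub_iff_add_eq] at h1 h2 h3 h4
    rw [h1, h2, h3, h4] at hN'
    rw [← hN']
    simp only [coordNijenhuis, T, map_sub, map_add, hJJ0]
    abel
  refine hnd _ fun w ↦ ?_
  have := congrArg (fun x ↦ γ x (A (h w))) hsum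
  simpa [hγT, hγJT, hγJJT] using this

end NormedCalculus

/-! ### Involutions: integrable eigendistributions and the Nijenhuis tensor -/

section ParaComplex

variable {E : Type*} [NormedAddCommGroup E] [NormedSpace ℝ E] [FiniteDimensional ℝ E]
  {M : Type*} [TopologicalSpace M] [ChartedSpace E M] [IsManifold 𝓘(ℝ, E) ∞ M]

lemma mem_eigenDistribution {F : Endo E M} {c : ℝ} {x : M} {v : TangentSpace 𝓘(ℝ, E) x} :
    v ∈ eigenDistribution F c x ↔ F x v = c • v := by
  simp [eigenDistribution, sub_eq_zero]

lemma SmoothVF.add_smul_evalEndo {F : Endo E M} (hF : SmoothEndo F) {X : VectorField E M}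
    {U : Set M} (hU : IsOpen U) (hX : SmoothVF X U) (c : ℝ) :
    SmoothVF (X + c • evalEndo F X) U := by
  intro x hx
  have h1 := hX.contMDiffAt hU hx
  have h2 := hF.contMDiffAt_apply h1
  exact (h1.add_section (h2.const_smul_section (a := c))).contMDiffWithinAt

/-- A smooth field of involutions with integrable eigendistributions has vanishing Nijenhuis
tensor. -/
lemma nijenhuisVanishes_of_isIntegrable {F : Endo E M} (hF : SmoothEndo F)
    (hsq : ∀ x v, F x (F x v) = v) (h₁ : IsIntegrable (eigenDistribution F 1))
    (h₂ : IsIntegrable (eigenDistribution F (-1))) : NijenhuisVanishes F := by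
  have : IsManifold 𝓘(ℝ, E) (minSmoothness ℝ 2) M := .of_le (n := ∞) (by simpa using two_le_infty)
  intro U hU X Y hX hY x hx
  have dX := (hX.contMDiffAt hU hx).mdifferentiableAt (by simp)
  have dY := (hY.contMDiffAt hU hx).mdifferentiableAt (by simp)
  have dFX := (hF.contMDiffAt_apply (hX.contMDiffAt hU hx)).mdifferentiableAt (by simp)
  have dFY := (hF.contMDiffAt_apply (hY.contMDiffAt hU hx)).mdifferentiableAt (by simp)
  -- `X + c FX` is a section of the `c`-eigendistribution because `F² = 1` and `c² = 1`. The
  -- relation expands the fact that the bracket of two such sections is again one.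
  have key : ∀ c : ℝ, c * c = 1 → IsIntegrable (eigenDistribution F c) →
      F x (bracket X Y x) + c • F x (bracket X (evalEndo F Y) x)
        + c • F x (bracket (evalEndo F X) Y x) + F x (bracket (evalEndo F X) (evalEndo F Y) x)
      = c • bracket X Y x + bracket X (evalEndo F Y) x
        + bracket (evalEndo F X) Y x + c • bracket (evalEndo F X) (evalEndo F Y) x := by
    intro c hc hint
    have hm : ∀ (Z : VectorField E M), ∀ y ∈ U,
        (Z + c • evalEndo F Z) y ∈ eigenDistribution F c y := by
      intro Z y _
      rw [mem_eigenDistribution]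
      simp [hsq, smul_smul, hc]
      abel
    have h := mem_eigenDistribution.1 (hint U hU _ _ (hX.add_smul_evalEndo hF hU c)
      (hY.add_smul_evalEndo hF hU c) (hm X) (hm Y) x hx)
    have dcY : MDifferentiableAt 𝓘(ℝ, E) 𝓘(ℝ, E).tangent
      (fun x ↦ (⟨x, (c • evalEndo F Y) x⟩ : TangentBundle 𝓘(ℝ, E) M)) x :=
      ((hF.contMDiffAt_apply (hY.contMDiffAt hU hx)).const_smul_section
        (a := c)).mdifferentiableAt (by simp)
    have dcX : MDifferentiableAt 𝓘(ℝ, E) 𝓘(ℝ, E).tangent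
      (fun x ↦ (⟨x, (c • evalEndo F X) x⟩ : TangentBundle 𝓘(ℝ, E) M)) x :=
      ((hF.contMDiffAt_apply (hX.contMDiffAt hU hx)).const_smul_section
        (a := c)).mdifferentiableAt (by simp)
    have dY' := ((hY.add_smul_evalEndo hF hU c).contMDiffAt hU hx).mdifferentiableAt (by simp)
    have e : bracket (X + c • evalEndo F X) (Y + c • evalEndo F Y) x
        = bracket X Y x + c • bracket X (evalEndo F Y) x + (c • bracket (evalEndo F X) Y x
          + bracket (evalEndo F X) (evalEndo F Y) x) := by
      unfold bracket
      rw [mlieBracket_add_left dX dcX, mlieBracket_add_right dY dcY, mlieBracket_add_right dY dcY,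
        mlieBracket_const_smul_right dFY, mlieBracket_const_smul_right dFY,
        mlieBracket_const_smul_left dFX, mlieBracket_const_smul_left dFX, smul_smul, hc, one_smul]
    rw [e] at h
    simp only [map_add, map_smul, smul_add, smul_smul, hc, one_smul] at h
    rw [← add_assoc, ← add_assoc] at h
    exact h
  have k₁ := key 1 (by norm_num) h₁
  have k₂ := key (-1) (by norm_num) h₂
  rw [hsq]
  -- Half the difference cancels `F[X, Y]`, `F[FX, FY]`, `[X, FY]` and `[FX, Y]`; the remaining
  -- terms form the Nijenhuis expression.
  linear_combination (norm := module) (-(1 / 2) : ℝ) • k₁ + (1 / 2 : ℝ) • k₂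

/-- The eigendistributions of a smooth field of involutions with vanishing Nijenhuis tensor are
integrable. -/
lemma NijenhuisVanishes.isIntegrable_eigenDistribution {F : Endo E M}
    (hsq : ∀ x v, F x (F x v) = v) (h : NijenhuisVanishes F) {c : ℝ} (hc : c * c = 1) :
    IsIntegrable (eigenDistribution F c) := by
  have : IsManifold 𝓘(ℝ, E) (minSmoothness ℝ 2) M := .of_le (n := ∞) (by simpa using two_le_infty)
  intro U hU X Y hX hY hmX hmY x hx
  have dX := (hX.contMDiffAt hU hx).mdifferentiableAt (by simp)
  have dY := (hY.contMDiffAt hU hx).mdifferentiableAt (by simp)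
  have e : ∀ Z : VectorField E M, (∀ x ∈ U, Z x ∈ eigenDistribution F c x) →
      evalEndo F Z =ᶠ[𝓝 x] c • Z := by
    intro Z hZ
    filter_upwards [hU.mem_nhds hx] with y hy using mem_eigenDistribution.1 (hZ y hy)
  -- As `F` acts by `c` on `X` and `Y` near `x`, this becomes `2[X, Y] - 2c F[X, Y] = 0`.
  have hN := h U hU X Y hX hY x hx
  have dcY : MDifferentiableAt 𝓘(ℝ, E) 𝓘(ℝ, E).tangent
      (fun x ↦ (⟨x, (c • Y) x⟩ : TangentBundle 𝓘(ℝ, E) M)) x :=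
    ((hY.contMDiffAt hU hx).const_smul_section (a := c)).mdifferentiableAt (by simp)
  rw [bracket, bracket, bracket, (e X hmX).mlieBracket_vectorField_eq (e Y hmY),
    (e X hmX).mlieBracket_vectorField_eq (EventuallyEq.refl _ Y),
    (EventuallyEq.refl _ X).mlieBracket_vectorField_eq (e Y hmY),
    mlieBracket_const_smul_left dX, mlieBracket_const_smul_left dX,
    mlieBracket_const_smul_right dY, smul_smul, hc, hsq] at hN
  simp only [map_smul, one_smul] at hN
  rw [mem_eigenDistribution]
  have := congrArg (fun v ↦ c • v) hN
  simp only [smul_sub, smul_add, smul_smul, hc, one_smul, smul_zero] at this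
  linear_combination (norm := module) (-(1 / 2) : ℝ) • this

end ParaComplex

/-! ### Linear algebra of non-degenerate forms -/

section LinearAlgebra

variable {V V' V'' : Type*} [NormedAddCommGroup V] [NormedSpace ℝ V] [FiniteDimensional ℝ V]
  [NormedAddCommGroup V'] [NormedSpace ℝ V'] [FiniteDimensional ℝ V']
  [NormedAddCommGroup V''] [NormedSpace ℝ V''] [FiniteDimensional ℝ V'']

lemma finrank_continuousDual : Module.finrank ℝ (V →L[ℝ] ℝ) = Module.finrank ℝ V :=
  (LinearMap.toContinuousLinearMap (𝕜 := ℝ) (E := V) (F' := ℝ)).finrank_eq.symm.trans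
    (Subspace.dual_finrank_eq (K := ℝ) (V := V))

/-- An injective map to the dual is bijective by dimension. Hence `ContinuousLinearMap.inverse`,
which is zero on non-invertible maps, is a true inverse here. -/
lemma isInvertible_of_nondegenerateOn_top {B : V →L[ℝ] V →L[ℝ] ℝ} (h : NondegenerateOn B ⊤) :
    B.IsInvertible := by
  have hinj : Injective (B : V →ₗ[ℝ] V →L[ℝ] ℝ) := by
    rw [← LinearMap.ker_eq_bot, LinearMap.ker_eq_bot']
    exact fun v hv ↦ h v trivial fun w _ ↦ DFunLike.congr_fun hv w
  exact ⟨((B : V →ₗ[ℝ] V →L[ℝ] ℝ).linearEquivOfInjective hinj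
    finrank_continuousDual.symm).toContinuousLinearEquiv, by ext; rfl⟩

lemma apply_inverse_of_nondegenerateOn_top {B : V →L[ℝ] V →L[ℝ] ℝ} (h : NondegenerateOn B ⊤)
    (α : V →L[ℝ] ℝ) : B (B.inverse α) = α := by
  obtain ⟨e, rfl⟩ := isInvertible_of_nondegenerateOn_top h
  rw [ContinuousLinearMap.inverse_equiv]
  exact e.apply_symm_apply α

lemma ext_of_nondegenerateOn_top {B : V →L[ℝ] V →L[ℝ] ℝ} (h : NondegenerateOn B ⊤) {v v' : V}
    (hv : ∀ w, B v w = B v' w) : v = v' := by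
  refine sub_eq_zero.1 (h _ trivial fun w _ ↦ ?_)
  simp [hv]

/-- The eigenspaces of an involution which is skew with respect to a non degenerate form have the
same dimension. -/
lemma finrank_eigenspace_le {B : V →L[ℝ] V →L[ℝ] ℝ} (h : NondegenerateOn B ⊤) {F : V →L[ℝ] V}
    (hsq : ∀ v, F (F v) = v) (hF : ∀ v w, B (F v) w = - B v (F w)) {c : ℝ} (hc : c * c = 1)
    {P N : Submodule ℝ V} (hP : ∀ v, v ∈ P ↔ F v = c • v) (hN : ∀ v, v ∈ N ↔ F v = (-c) • v) :
    Module.finrank ℝ P ≤ Module.finrank ℝ N := by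
  -- Eigenspaces are isotropic: skewness gives `c B(v, w) = -c B(v, w)`.
  have hPP : ∀ v ∈ P, ∀ w ∈ P, B v w = 0 := by
    intro v hv w hw
    have := hF v w
    rw [(hP v).1 hv, (hP w).1 hw] at this
    simp only [map_smul, _root_.smul_apply, smul_eq_mul] at this
    have h2 : c * B v w = 0 := by linarith
    have h3 : c * (c * B v w) = 0 := by rw [h2, mul_zero]
    rwa [← mul_assoc, hc, one_mul] at h3
  -- The pairing of `P` with `N` is injective on `P`: `2w` is the sum of `w + c Fw` in `P` and `w -
  -- c Fw` in `N`, and `P` is isotropic.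
  let L : P →ₗ[ℝ] Module.Dual ℝ N :=
    { toFun := fun v ↦ (B v : V →ₗ[ℝ] ℝ).comp N.subtype
      map_add' := by intros; ext; simp
      map_smul' := by intros; ext; simp }
  have hL : Injective L := by
    rw [← LinearMap.ker_eq_bot, LinearMap.ker_eq_bot']
    intro v hv
    refine Subtype.ext (h _ trivial fun w _ ↦ ?_)
    have h1 : w + c • F w ∈ P := by
      rw [hP]; simp [hsq, smul_smul, hc, add_comm]
    have h2 : w - c • F w ∈ N := by
      rw [hN]; simp [hsq, smul_smul, hc, sub_eq_add_neg, add_comm]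
    have h3 := hPP v v.2 _ h1
    have h4 : B v (w - c • F w) = 0 := DFunLike.congr_fun hv ⟨_, h2⟩
    simp only [map_add, map_sub] at h3 h4
    linarith
  exact (LinearMap.finrank_le_finrank_of_injective hL).trans_eq Subspace.dual_finrank_eq

/-- The double orthogonal of a subspace with respect to a non degenerate alternating form. -/
lemma mem_of_orth_orth {ω : V →L[ℝ] V →L[ℝ] ℝ} (h : NondegenerateOn ω ⊤)
    (halt : ∀ v w, ω v w = - ω w v) {W : Submodule ℝ V} {v : V} (hv : ∀ u ∈ orth ω W, ω v u = 0) :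
    v ∈ W := by
  let B : LinearMap.BilinForm ℝ V := LinearMap.mk₂ ℝ (fun v w ↦ ω v w) (by simp) (by simp)
    (by simp) (by simp)
  have hrefl : B.IsRefl := fun v w hvw ↦ by
    change ω w v = 0
    rw [halt]
    exact neg_eq_zero.2 hvw
  have hnd : B.Nondegenerate := by
    refine hrefl.nondegenerate_iff_separatingLeft.2 ?_
    exact fun v hv ↦ h v trivial fun w _ ↦ hv w
  rw [← LinearMap.BilinForm.orthogonal_orthogonal hnd hrefl W]
  intro u hu
  change ω u v = 0
  rw [halt, hv u, neg_zero]
  intro w hw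
  rw [halt]
  exact neg_eq_zero.2 (hu w hw)

section HorizontalLift

variable {g : V' →L[ℝ] V' →L[ℝ] ℝ} {K : Submodule ℝ V'} {b : V' →L[ℝ] V''}

/-- A subspace on which a form is non degenerate is complemented by its orthogonal. -/
lemma exists_sub_mem_orth (hK : NondegenerateOn g K) (v : V') :
    ∃ k ∈ K, v - k ∈ orth g K := by
  -- Injective by non-degeneracy, hence onto by dimension; `k` represents the restriction of `g v`
  -- to `K`.
  let L : K →ₗ[ℝ] Module.Dual ℝ K :=
    { toFun := fun v ↦ (g v : V' →ₗ[ℝ] ℝ).comp K.subtype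
      map_add' := by intros; ext; simp
      map_smul' := by intros; ext; simp }
  have hL : Injective L := by
    rw [← LinearMap.ker_eq_bot, LinearMap.ker_eq_bot']
    exact fun v hv ↦ Subtype.ext (hK _ v.2 fun w hw ↦ DFunLike.congr_fun hv ⟨w, hw⟩)
  obtain ⟨k, hk⟩ := (LinearMap.injective_iff_surjective_of_finrank_eq_finrank
    (Subspace.dual_finrank_eq (K := ℝ) (V := K)).symm).1 hL ((g v : V' →ₗ[ℝ] ℝ).comp K.subtype)
  refine ⟨k, k.2, fun w hw ↦ ?_⟩
  have : g k w = g v w := DFunLike.congr_fun hk ⟨w, hw⟩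
  simp [this]

variable (hK : NondegenerateOn g K) (hb : Surjective b)
  (hker : ∀ v, v ∈ K ↔ b v = 0)

include hK hb hker in
/-- Every vector has a horizontal lift. -/
lemma exists_horizontalLift (u : V'') : ∃ h ∈ orth g K, b h = u := by
  obtain ⟨v, rfl⟩ := hb u
  obtain ⟨k, hk, hv⟩ := exists_sub_mem_orth hK v
  exact ⟨v - k, hv, by simp [(hker k).1 hk]⟩

end HorizontalLift

end LinearAlgebra

/-! ### The endomorphism `♯_ω ∘ ♭_γ` -/

section StructureEndo

variable {E : Type*} [NormedAddCommGroup E] [NormedSpace ℝ E] [FiniteDimensional ℝ E]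
  {M : Type*} [TopologicalSpace M] [ChartedSpace E M]
  {ω γ : Bilin E M}

lemma Nondegenerate.ext {B : Bilin E M} (h : Nondegenerate B) {x : M}
    {v v' : TangentSpace 𝓘(ℝ, E) x} (hv : ∀ w, B x v w = B x v' w) : v = v' :=
  ext_of_nondegenerateOn_top (V := E) (h x) hv

lemma Nondegenerate.apply_sharp {B : Bilin E M} (h : Nondegenerate B) (x : M)
    (α : TangentSpace 𝓘(ℝ, E) x →L[ℝ] ℝ) : B x (sharp B x α) = α :=
  apply_inverse_of_nondegenerateOn_top (V := E) (h x) α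

lemma apply_structureEndo (hω : Nondegenerate ω) (γ : Bilin E M) (x : M)
    (v w : TangentSpace 𝓘(ℝ, E) x) : ω x (structureEndo ω γ x v) w = γ x v w :=
  DFunLike.congr_fun (hω.apply_sharp x (γ x v)) w

lemma apply_structureEndo_eq_neg (hγ : Nondegenerate γ)
    (h : ∀ x, sharp ω x ∘L flat γ x = -(sharp γ x ∘L flat ω x)) (x : M)
    (v w : TangentSpace 𝓘(ℝ, E) x) : γ x (structureEndo ω γ x v) w = - ω x v w := by
  rw [structureEndo, h]
  simp only [_root_.neg_apply, map_neg]
  exact congrArg Neg.neg (DFunLike.congr_fun (hγ.apply_sharp x (ω x v)) w)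

lemma apply_structureEndo_eq (hγ : Nondegenerate γ)
    (h : ∀ x, sharp ω x ∘L flat γ x = sharp γ x ∘L flat ω x) (x : M)
    (v w : TangentSpace 𝓘(ℝ, E) x) : γ x (structureEndo ω γ x v) w = ω x v w := by
  rw [structureEndo, h]
  exact DFunLike.congr_fun (hγ.apply_sharp x (ω x v)) w

lemma skew_of_alternating (hω : ∀ x v, ω x v v = 0) (x : M) (v w : TangentSpace 𝓘(ℝ, E) x) :
    ω x v w = - ω x w v := by
  have := hω x (v + w)
  simp only [map_add, _root_.add_apply, hω] at this
  linarith

variable [IsManifold 𝓘(ℝ, E) ∞ M]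

lemma Param.contMDiffAt_pushField {E₁ : Type*} [NormedAddCommGroup E₁] [NormedSpace ℝ E₁]
    (Φ : Param E₁ E M) {z : E₁} (hz : z ∈ Φ.source) {Z : E₁ → E₁} (hZ : ContDiffAt ℝ ∞ Z z) :
    ContMDiffAt 𝓘(ℝ, E) 𝓘(ℝ, E).tangent ∞
      (fun x ↦ (⟨x, Φ.pushField Z x⟩ : TangentBundle 𝓘(ℝ, E) M)) (Φ z) := by
  refine ContMDiffAt.mpullback_vectorField_preimage (V := Z) ?_
    (Φ.contMDiffAt_symm (Φ.map_source hz)) (Φ.isInvertible_mfderiv_symm (Φ.map_source hz)) le_rfl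
  rw [Φ.symm_apply hz]
  exact contMDiffAt_vectorSpace_iff_contDiffAt.2 hZ

lemma Param.nondegenerateOn_coordBilin {E₁ : Type*} [NormedAddCommGroup E₁] [NormedSpace ℝ E₁]
    (Φ : Param E₁ E M) {z : E₁} (hz : z ∈ Φ.source) {B : Bilin E M} (hB : Nondegenerate B) :
    NondegenerateOn (coordBilin Φ B z) ⊤ := by
  intro v _ hv
  refine (Φ.deriv hz).injective ((hB (Φ z) _ trivial fun w _ ↦ ?_).trans (map_zero _).symm)
  have := hv (mfderiv 𝓘(ℝ, E) 𝓘(ℝ, E₁) Φ.symm (Φ z) w) trivial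
  exact (congrArg (B (Φ z) _) (Φ.mfderiv_apply_symm hz w)).symm.trans this

lemma contDiffAt_inverse_of_nondegenerateOn {D V : Type*} [NormedAddCommGroup D]
    [NormedSpace ℝ D] [NormedAddCommGroup V] [NormedSpace ℝ V] [FiniteDimensional ℝ V]
    {B : D → V →L[ℝ] V →L[ℝ] ℝ} {z : D} (hB : ContDiffAt ℝ ∞ B z) (h : NondegenerateOn (B z) ⊤) :
    ContDiffAt ℝ ∞ (fun y ↦ (B y).inverse) z := by
  obtain ⟨e, he⟩ := isInvertible_of_nondegenerateOn_top h
  have := contDiffAt_map_inverse (n := ∞) e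
  rw [he] at this
  exact this.comp z hB

/-- In coordinates the endomorphism is the inverse of `ω` composed with `γ`, and inversion is smooth
at invertible operators. -/
lemma smoothEndo_structureEndo (hω : SmoothBilin ω) (hnd : Nondegenerate ω)
    (hγ : SmoothBilin γ) : SmoothEndo (structureEndo ω γ) := by
  refine smoothEndo_of_apply fun x₀ X hX ↦ ?_
  obtain ⟨Φ, z, hz, rfl⟩ := exists_param (E := E) x₀
  have h1 : ContDiffAt ℝ ∞ (fun y ↦ (coordBilin Φ ω y).inverse
      (coordBilin Φ γ y (Φ.coordField X y))) z :=
    (contDiffAt_inverse_of_nondegenerateOn (contDiffAt_coordBilin hω (Φ.contMDiffAt hz))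
      (Φ.nondegenerateOn_coordBilin hz hnd)).clm_apply
      ((contDiffAt_coordBilin hγ (Φ.contMDiffAt hz)).clm_apply (Φ.contDiffAt_coordField hz hX))
  refine (Φ.contMDiffAt_pushField hz h1).congr_of_eventuallyEq ?_
  filter_upwards [Φ.open_target.mem_nhds (Φ.map_source hz)] with x hx
  obtain ⟨y, hy, rfl⟩ : ∃ y ∈ Φ.source, Φ y = x := ⟨Φ.symm x, Φ.map_target hx, Φ.right_inv hx⟩
  congr 1
  rw [Φ.pushField_apply hy]
  refine (Φ.mfderiv_coordField hy (evalEndo (structureEndo ω γ) X)).symm.trans (congrArg _ ?_)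
  refine ext_of_nondegenerateOn_top (Φ.nondegenerateOn_coordBilin hy hnd) fun w ↦ ?_
  rw [apply_inverse_of_nondegenerateOn_top (Φ.nondegenerateOn_coordBilin hy hnd),
    coordBilin_apply, coordBilin_apply, Φ.mfderiv_coordField hy, Φ.mfderiv_coordField hy,
    apply_structureEndo hnd]

/-- If `♯_ω ∘ ♭_γ = -♯_γ ∘ ♭_ω`, then `♯_ω ∘ ♭_γ` and `γ` form an almost Hermitian structure. -/
lemma isAlmostHermitian_structureEndo (hω : IsAlmostSymplectic ω) (hγ : IsPseudoMetric γ)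
    (h : ∀ x v w, γ x (structureEndo ω γ x v) w = - ω x v w) :
    IsAlmostHermitian (structureEndo ω γ) γ ω where
  metric := hγ
  smooth := smoothEndo_structureEndo hω.smooth hω.nondegenerate hγ.smooth
  sq x v := hω.nondegenerate.ext fun w ↦ by
    rw [apply_structureEndo hω.nondegenerate, h]
    simp
  compatible x v w := by
    rw [h, skew_of_alternating hω.alternating, apply_structureEndo hω.nondegenerate, hγ.symm,
      neg_neg]
  fundamental x v w := by
    rw [hγ.symm, h, ← skew_of_alternating hω.alternating]

/-- If `♯_ω ∘ ♭_γ = ♯_γ ∘ ♭_ω`, then `♯_ω ∘ ♭_γ` and `γ` form an almost para-Hermitian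
structure. -/
lemma isAlmostParaHermitian_structureEndo (hω : IsAlmostSymplectic ω) (hγ : IsPseudoMetric γ)
    (h : ∀ x v w, γ x (structureEndo ω γ x v) w = ω x v w) :
    IsAlmostParaHermitian (structureEndo ω γ) γ ω := by
  have hsq : ∀ x v, structureEndo ω γ x (structureEndo ω γ x v) = v := fun x v ↦
    hω.nondegenerate.ext fun w ↦ by rw [apply_structureEndo hω.nondegenerate, h]
  have hskew : ∀ x v w, γ x (structureEndo ω γ x v) w = - γ x v (structureEndo ω γ x w) :=
    fun x v w ↦ by
      rw [hγ.symm x v, h, h, skew_of_alternating hω.alternating]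
  refine ⟨hγ, smoothEndo_structureEndo hω.smooth hω.nondegenerate hγ.smooth, hsq, fun x ↦ ?_,
    hskew, fun x v w ↦ (h x v w).symm⟩
  refine le_antisymm ?_ ?_
  · exact finrank_eigenspace_le (V := E) (hγ.nondegenerate x) (hsq x) (hskew x) (c := 1)
      (by norm_num) (fun v ↦ mem_eigenDistribution (x := x)) (fun v ↦ mem_eigenDistribution (x := x))
  · exact finrank_eigenspace_le (V := E) (hγ.nondegenerate x) (hsq x) (hskew x) (c := -1)
      (by norm_num) (fun v ↦ mem_eigenDistribution (x := x))
      (fun v ↦ by rw [neg_neg]; exact mem_eigenDistribution (x := x))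

end StructureEndo

/-! ### Submersions: adapted charts, local sections, vertical vectors -/

section Submersion

variable {E' : Type*} [NormedAddCommGroup E'] [NormedSpace ℝ E'] [FiniteDimensional ℝ E']
  {E'' : Type*} [NormedAddCommGroup E''] [NormedSpace ℝ E''] [FiniteDimensional ℝ E'']
  {N : Type*} [TopologicalSpace N] [ChartedSpace E' N]
  {Q : Type*} [TopologicalSpace Q] [ChartedSpace E'' Q]

variable (E' E'') in
/-- Parametrizations of `N` and `Q` in which a map `p : N → Q` is a split linear projection. -/
structure SubmersionChart (p : N → Q) where
  /-- parametrization of the domain -/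
  dom : Param E' E' N
  /-- parametrization of the codomain -/
  cod : Param E'' E'' Q
  /-- the projection -/
  proj : E' →L[ℝ] E''
  /-- a section of the projection -/
  lift : E'' →L[ℝ] E'
  proj_lift : ∀ u, proj (lift u) = u
  proj_mem : ∀ z ∈ dom.source, proj z ∈ cod.source
  apply_dom : ∀ z ∈ dom.source, p (dom z) = cod (proj z)

/-- The local normal form: `p` becomes the first projection under a splitting `E' ≃ E'' × F`, and
the inclusion of the first factor is the section. -/
lemma exists_submersionChart {p : N → Q} (hp : Manifold.IsSubmersion 𝓘(ℝ, E') 𝓘(ℝ, E'') ∞ p)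
    (y : N) : ∃ (c : SubmersionChart E' E'' p) (z : E'), z ∈ c.dom.source ∧ c.dom z = y := by
  obtain ⟨F, _, _, h⟩ := hp.isSubmersionAt y
  have hw := h.writtenInCharts
  have ht := h.target_subset_preimage_target
  rw [OpenPartialHomeomorph.extend_target] at hw ht
  simp only [OpenPartialHomeomorph.extend_target] at ht
  refine ⟨⟨chartParam h.domChart h.domChart_mem_maximalAtlas,
    chartParam h.codChart h.codChart_mem_maximalAtlas,
    ContinuousLinearMap.fst ℝ E'' F ∘L (h.equiv : E' →L[ℝ] E'' × F),
    (h.equiv.symm : E'' × F →L[ℝ] E') ∘L ContinuousLinearMap.inl ℝ E'' F, ?_, ?_, ?_⟩,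
    h.domChart y, h.domChart.map_source h.mem_domChart_source,
    h.domChart.left_inv h.mem_domChart_source⟩
  · intro u
    simp
  · intro z hz
    have hz' : z ∈ h.domChart.target := hz
    have := ht (a := z) (by simpa using hz')
    change _ ∈ h.codChart.target
    simpa using this
  · intro z hz
    have hz' : z ∈ h.domChart.target := hz
    have h1 := hw (x := z) (by simpa using hz')
    have h2 : p (h.domChart.symm z) ∈ h.codChart.source :=
      h.source_subset_preimage_source (h.domChart.map_target hz)
    have h3 : h.codChart (p (h.domChart.symm z)) = (h.equiv z).1 := by simpa using h1
    change p (h.domChart.symm z) = h.codChart.symm (h.equiv z).1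
    rw [← h3, h.codChart.left_inv h2]

variable [IsManifold 𝓘(ℝ, E') ∞ N] [IsManifold 𝓘(ℝ, E'') ∞ Q]

namespace SubmersionChart

variable {p : N → Q} (c : SubmersionChart E' E'' p) {z : E'}

lemma mfderiv_apply (hp : ContMDiff 𝓘(ℝ, E') 𝓘(ℝ, E'') ∞ p) (hz : z ∈ c.dom.source) (u : E') :
    (mfderiv 𝓘(ℝ, E') 𝓘(ℝ, E'') p (c.dom z) (mfderiv 𝓘(ℝ, E') 𝓘(ℝ, E') c.dom z u) : E'')
      = mfderiv 𝓘(ℝ, E'') 𝓘(ℝ, E'') c.cod (c.proj z) (c.proj u) := by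
  have h1 := mfderiv_comp z ((hp _).mdifferentiableAt (by simp)) (c.dom.mdiffAt hz)
  have h2 : p ∘ c.dom =ᶠ[𝓝 z] c.cod ∘ c.proj := by
    filter_upwards [c.dom.open_source.mem_nhds hz] with y hy using c.apply_dom y hy
  have h3 := mfderiv_comp z (c.cod.mdiffAt (c.proj_mem z hz))
    c.proj.differentiableAt.mdifferentiableAt
  have h4 := h1.symm.trans (h2.mfderiv_eq.trans h3)
  rw [mfderiv_eq_fderiv, c.proj.fderiv] at h4
  exact DFunLike.congr_fun h4 u

lemma mfderiv_eq_zero_iff (hp : ContMDiff 𝓘(ℝ, E') 𝓘(ℝ, E'') ∞ p) (hz : z ∈ c.dom.source)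
    (u : E') : mfderiv 𝓘(ℝ, E') 𝓘(ℝ, E'') p (c.dom z) (mfderiv 𝓘(ℝ, E') 𝓘(ℝ, E') c.dom z u) = 0
      ↔ c.proj u = 0 := by
  have h := c.mfderiv_apply hp hz u
  have h2 := (c.cod.deriv (c.proj_mem z hz)).map_eq_zero_iff (x := c.proj u)
  exact (show _ ↔ _ from ⟨fun h' ↦ h.symm.trans h', fun h' ↦ h.trans h'⟩).trans h2

lemma exists_mfderiv_dom_eq (hz : z ∈ c.dom.source) (v : E') :
    ∃ u : E', (mfderiv 𝓘(ℝ, E') 𝓘(ℝ, E') c.dom z u : E') = v :=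
  (c.dom.deriv hz).surjective v

end SubmersionChart

lemma surjective_mfderiv_of_isSubmersion {p : N → Q}
    (hp : Manifold.IsSubmersion 𝓘(ℝ, E') 𝓘(ℝ, E'') ∞ p) (y : N) :
    Surjective (mfderiv 𝓘(ℝ, E') 𝓘(ℝ, E'') p y) := by
  obtain ⟨c, z, hz, rfl⟩ := exists_submersionChart hp y
  intro u
  obtain ⟨w, hw⟩ := (c.cod.deriv (c.proj_mem z hz)).surjective u
  refine ⟨mfderiv 𝓘(ℝ, E') 𝓘(ℝ, E') c.dom z (c.lift w), ?_⟩
  refine (c.mfderiv_apply hp.contMDiff hz _).trans ?_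
  exact (congrArg (c.cod.deriv (c.proj_mem z hz)) (c.proj_lift w)).trans hw

/-- Local sections of a submersion. -/
lemma exists_section {p : N → Q} (hp : Manifold.IsSubmersion 𝓘(ℝ, E') 𝓘(ℝ, E'') ∞ p) (y : N) :
    ∃ (s : Q → N) (V : Set Q), IsOpen V ∧ p y ∈ V ∧ ContMDiffOn 𝓘(ℝ, E'') 𝓘(ℝ, E') ∞ s V ∧
      ∀ q ∈ V, p (s q) = q := by
  obtain ⟨c, z, hz, rfl⟩ := exists_submersionChart hp y
  -- The affine section of the linear projection that passes through `z`.
  let a : E'' → E' := fun w ↦ z + c.lift (w - c.proj z)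
  have ha : ContDiff ℝ ∞ a := by fun_prop
  have hpa : ∀ w, c.proj (a w) = w := by simp [a, c.proj_lift]
  let W : Set E'' := a ⁻¹' c.dom.source ∩ c.cod.source
  have hW : IsOpen W := (c.dom.open_source.preimage ha.continuous).inter c.cod.open_source
  refine ⟨c.dom ∘ a ∘ c.cod.symm, c.cod.target ∩ c.cod.symm ⁻¹' W,
    c.cod.symm.contMDiffOn.continuousOn.isOpen_inter_preimage c.cod.open_target hW, ?_, ?_, ?_⟩
  · rw [c.apply_dom z hz]
    refine ⟨c.cod.map_source (c.proj_mem z hz), ?_⟩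
    rw [mem_preimage, c.cod.symm_apply (c.proj_mem z hz)]
    refine ⟨?_, c.proj_mem z hz⟩
    simpa [a] using hz
  · refine c.dom.contMDiffOn.comp (ha.contMDiff.comp_contMDiffOn
      (c.cod.symm.contMDiffOn.mono inter_subset_left)) ?_
    exact fun q hq ↦ hq.2.1
  · intro q hq
    change p (c.dom (a (c.cod.symm q))) = q
    rw [c.apply_dom _ hq.2.1, hpa, c.cod.apply_symm hq.1]

/-- A map which is constant on the leaves of a distribution has a differential which vanishes on
the smooth vector fields tangent to the distribution. -/
lemma mfderiv_eq_zero_of_sameLeaf {p : N → Q} (hp : ContMDiff 𝓘(ℝ, E') 𝓘(ℝ, E'') ∞ p)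
    {D : Distribution E' N} (hD : ∀ x y, SameLeaf D x y → p x = p y) {U : Set N} (hU : IsOpen U)
    {X : VectorField E' N} (hX : SmoothVF X U) (hXD : ∀ y ∈ U, X y ∈ D y) {y : N} (hy : y ∈ U) :
    mfderiv 𝓘(ℝ, E') 𝓘(ℝ, E'') p y (X y) = 0 := by
  have : IsManifold 𝓘(ℝ, E') 1 N := .of_le (n := ∞) (by simp)
  obtain ⟨γ, rfl, hγ⟩ := exists_isMIntegralCurveAt_of_contMDiffAt_boundaryless (I := 𝓘(ℝ, E'))
    (v := X) (x₀ := y) 0 ((hX.contMDiffAt hU hy).of_le (by simp))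
  have hγ' := hγ
  have hUγ : ∀ᶠ t in 𝓝 (0 : ℝ), γ t ∈ U := hγ.continuousAt.eventually (hU.mem_nhds hy)
  obtain ⟨ε, hε, hball⟩ := Metric.eventually_nhds_iff_ball.1 (hγ'.and hUγ)
  have hconst : ∀ s ∈ Metric.ball (0 : ℝ) ε, p (γ s) = p (γ 0) := by
    intro s hs
    -- `SameLeaf` asks for arcs on all of `ℝ`, while the integral curve is controlled only on a ball
    -- around `0`. Reparametrized by `s * sin (π t / 2)` it stays in the ball, starts at time `0` of
    -- the curve and reaches `s` at `t = 1`.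
    refine (hD _ _ (Relation.ReflTransGen.single
      ⟨fun t ↦ γ (s * Real.sin (Real.pi / 2 * t)), ?_⟩)).symm
    have hmem : ∀ t : ℝ, s * Real.sin (Real.pi / 2 * t) ∈ Metric.ball (0 : ℝ) ε := by
      intro t
      rw [mem_ball_zero_iff, norm_mul] at *
      exact (mul_le_of_le_one_right (norm_nonneg _) (Real.abs_sin_le_one _)).trans_lt hs
    let f : ℝ → ℝ := fun t ↦ s * Real.sin (Real.pi / 2 * t)
    have hf : Differentiable ℝ f := by fun_prop
    have hder : ∀ t : ℝ, HasMFDerivAt 𝓘(ℝ, ℝ) 𝓘(ℝ, E') (γ ∘ f) t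
        ((ContinuousLinearMap.smulRight (1 : ℝ →L[ℝ] ℝ) (X (γ (f t)))) ∘L fderiv ℝ f t) :=
      fun t ↦ (hball _ (hmem t)).1.comp t (hf t).hasFDerivAt.hasMFDerivAt
    refine ⟨fun t ↦ (hder t).mdifferentiableAt, fun t ↦ ?_, by simp, by simp⟩
    have hm := (D (γ (f t))).smul_mem (fderiv ℝ f t 1) (hXD _ (hball _ (hmem t)).2)
    exact (congrArg (· ∈ D (γ (f t))) (DFunLike.congr_fun (hder t).mfderiv (1 : ℝ))).mpr hm
  have h1 := (hball 0 (Metric.mem_ball_self hε)).1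
  have h2 := ((hp (γ 0)).mdifferentiableAt (by simp)).hasMFDerivAt.comp (0 : ℝ) h1
  have h3 : p ∘ γ =ᶠ[𝓝 0] fun _ ↦ p (γ 0) := by
    filter_upwards [Metric.ball_mem_nhds (0 : ℝ) hε] with s hs using hconst s hs
  have h4 := hasMFDerivAt_unique h2
    ((hasMFDerivAt_const (I := 𝓘(ℝ, ℝ)) (p (γ 0)) (0 : ℝ)).congr_of_eventuallyEq h3)
  have h5 := DFunLike.congr_fun h4 (1 : ℝ)
  refine Eq.trans ?_ h5
  exact congrArg _ (one_smul ℝ (X (γ 0))).symm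

end Submersion

/-! ### Descent of an invariant form along a submersion -/

section Descent

variable {E' : Type*} [NormedAddCommGroup E'] [NormedSpace ℝ E'] [FiniteDimensional ℝ E']
  {E'' : Type*} [NormedAddCommGroup E''] [NormedSpace ℝ E''] [FiniteDimensional ℝ E'']
  {N : Type*} [TopologicalSpace N] [ChartedSpace E' N] [IsManifold 𝓘(ℝ, E') ∞ N]
  {Q : Type*} [TopologicalSpace Q] [ChartedSpace E'' Q] [IsManifold 𝓘(ℝ, E'') ∞ Q]
  {p : N → Q} {Ω : Bilin E' N}

/-- The bracket of a vertical vector field with a field which is constant in a submersion chart is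
vertical. -/
lemma SubmersionChart.mfderiv_bracket_eq_zero (c : SubmersionChart E' E'' p)
    (hp : ContMDiff 𝓘(ℝ, E') 𝓘(ℝ, E'') ∞ p) {z : E'} (hz : z ∈ c.dom.source) {U : Set N}
    (hU : IsOpen U) (hzU : c.dom z ∈ U) {X : VectorField E' N} (hX : SmoothVF X U)
    (hXp : ∀ y ∈ U, mfderiv 𝓘(ℝ, E') 𝓘(ℝ, E'') p y (X y) = 0) (u : E') :
    mfderiv 𝓘(ℝ, E') 𝓘(ℝ, E'') p (c.dom z)
      (bracket X (c.dom.pushField fun _ ↦ u) (c.dom z)) = 0 := by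
  have hX' := hX.contMDiffAt hU hzU
  rw [c.dom.mfderiv_lieBracket hz hX' (c.dom.contMDiffAt_pushField hz contDiffAt_const),
    c.mfderiv_eq_zero_iff hp hz, c.dom.fderiv_coordField_pushField_const hz,
    c.dom.coordField_pushField hz]
  have hd := ((c.dom.contDiffAt_coordField hz hX').differentiableAt (by simp)).hasFDerivAt
  -- Verticality says that `proj` kills the coordinates of `X` near `z`, hence also their
  -- derivative.
  have h0 : (fun y ↦ c.proj (c.dom.coordField X y)) =ᶠ[𝓝 z] fun _ ↦ 0 := by
    filter_upwards [c.dom.open_source.mem_nhds hz,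
      (c.dom.contMDiffAt hz).continuousAt.preimage_mem_nhds (hU.mem_nhds hzU)] with y hy hyU
    rw [← c.mfderiv_eq_zero_iff hp hy, c.dom.mfderiv_coordField hy]
    exact hXp _ hyU
  have h1 := (c.proj.hasFDerivAt.comp z hd).unique
    ((hasFDerivAt_const (0 : E'') z).congr_of_eventuallyEq h0)
  have h2 : c.proj (fderiv ℝ (c.dom.coordField X) z u) = 0 := DFunLike.congr_fun h1 u
  simp [h2]

/-- Two points of a fibre of `p` at which `Ω` induces the same form on the base. -/
def SameDescent (p : N → Q) (Ω : Bilin E' N) (y y' : N) : Prop :=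
  ∀ v w v' w' : E',
    (mfderiv 𝓘(ℝ, E') 𝓘(ℝ, E'') p y v : E'') = mfderiv 𝓘(ℝ, E') 𝓘(ℝ, E'') p y' v' →
    (mfderiv 𝓘(ℝ, E') 𝓘(ℝ, E'') p y w : E'') = mfderiv 𝓘(ℝ, E') 𝓘(ℝ, E'') p y' w' →
    Ω y v w = Ω y' v' w'

variable (hΩ : SmoothBilin Ω) (hskew : ∀ y v w, Ω y v w = - Ω y w v)
  (hp : Manifold.IsSubmersion 𝓘(ℝ, E') 𝓘(ℝ, E'') ∞ p)
  (hker : ∀ y v, mfderiv 𝓘(ℝ, E') 𝓘(ℝ, E'') p y v = 0 ↔ ∀ w, Ω y v w = 0)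
  (hauto : ∀ y : N, ∃ U : Set N, IsOpen U ∧ y ∈ U ∧ ∃ (k : ℕ) (X : Fin k → VectorField E' N),
    (∀ i, SmoothVF (X i) U) ∧ (∀ i, IsInfinitesimalAutomorphism Ω (X i) U) ∧
    (∀ i, ∀ z ∈ U, mfderiv 𝓘(ℝ, E') 𝓘(ℝ, E'') p z (X i z) = 0) ∧
    ∀ z ∈ U, ∀ v, mfderiv 𝓘(ℝ, E') 𝓘(ℝ, E'') p z v = 0 →
      v ∈ Submodule.span ℝ (range fun i ↦ X i z))

include hskew hker in
lemma apply_congr_of_mfderiv_eq {y : N} {v w v' w' : TangentSpace 𝓘(ℝ, E') y}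
    (hv : mfderiv 𝓘(ℝ, E') 𝓘(ℝ, E'') p y v = mfderiv 𝓘(ℝ, E') 𝓘(ℝ, E'') p y v')
    (hw : mfderiv 𝓘(ℝ, E') 𝓘(ℝ, E'') p y w = mfderiv 𝓘(ℝ, E') 𝓘(ℝ, E'') p y w') :
    Ω y v w = Ω y v' w' := by
  have h1 := (hker y (v - v')).1 (by rw [map_sub, hv, sub_self]) w
  have h2 := (hker y (w - w')).1 (by rw [map_sub, hw, sub_self]) v'
  rw [map_sub, _root_.sub_apply] at h1 h2
  rw [hskew y w v', hskew y w' v'] at h2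
  linarith

include hΩ hskew hp hker hauto in
-- By linearity the direction may be one of the spanning automorphisms `X i`. In `L_X Ω = 0` the
-- brackets of `X i` with the constant fields are vertical, so `Ω` kills them and only the
-- derivative of the component remains.
lemma fderiv_apply_lift_eq_zero (c : SubmersionChart E' E'' p) {z : E'} (hz : z ∈ c.dom.source)
    (u v k : E') (hk : c.proj k = 0) :
    fderiv ℝ (fun y ↦ coordBilin c.dom Ω y u v) z k = 0 := by
  obtain ⟨U, hU, hzU, n, X, hX, hXa, hXp, hspan⟩ := hauto (c.dom z)
  have hs : ∀ u : E', SmoothVF (c.dom.pushField fun _ ↦ u) c.dom.target := fun u ↦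
    c.dom.smoothVF_pushField contDiffOn_const
  have hm := c.dom.map_source hz
  have hs' := fun u ↦ (hs u).contMDiffAt c.dom.open_target hm
  have hf := hΩ.mdifferentiableAt_evalBilin (hs' u) (hs' v)
  have e : evalBilin Ω (c.dom.pushField fun _ ↦ u) (c.dom.pushField fun _ ↦ v) ∘ c.dom
      =ᶠ[𝓝 z] fun y ↦ coordBilin c.dom Ω y u v := by
    filter_upwards [c.dom.open_source.mem_nhds hz] with y hy
    rw [Function.comp_apply, evalBilin, c.dom.pushField_apply hy, c.dom.pushField_apply hy]
    rfl
  rw [← e.fderiv_eq, ← c.dom.dirDeriv_apply hz hf]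
  have hk' := hspan _ hzU _ ((c.mfderiv_eq_zero_iff hp.contMDiff hz k).2 hk)
  generalize mfderiv 𝓘(ℝ, E') 𝓘(ℝ, E') c.dom z k = w₀ at hk' ⊢
  induction hk' using Submodule.span_induction with
  | mem w hw =>
    obtain ⟨i, rfl⟩ := hw
    have h := hXa i _ (hU.inter c.dom.open_target) inter_subset_left _ _
      ((hs u).mono inter_subset_right) ((hs v).mono inter_subset_right) _ ⟨hzU, hm⟩
    have hb := fun u ↦ (hker _ _).1
      (c.mfderiv_bracket_eq_zero hp.contMDiff hz hU hzU (hX i) (hXp i) u)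
    rw [hb, hskew, hb] at h
    simpa using h
  | zero => exact map_zero _
  | add a b _ _ ha hb => exact (map_add _ a b).trans (by
      rw [dirDeriv] at ha hb
      exact (congrArg₂ (· + ·) ha hb).trans (add_zero 0))
  | smul r a _ ha => exact (map_smul _ r a).trans (by
      rw [dirDeriv] at ha
      exact (congrArg (r • ·) ha).trans (smul_zero r))

include hΩ hskew hp hker hauto in
-- In a ball of coordinates the segment joining two points with equal projection stays in the fibre,
-- and the components of `Ω` are constant along it.
lemma eventually_sameDescent (y₀ : N) : ∀ᶠ y in 𝓝 y₀, p y = p y₀ →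
    SameDescent (E'' := E'') p Ω y y₀ := by
  obtain ⟨c, z₀, hz₀, rfl⟩ := exists_submersionChart hp y₀
  obtain ⟨ε, hε, hball⟩ := Metric.isOpen_iff.1 c.dom.open_source z₀ hz₀
  have hnhds : c.dom.symm ⁻¹' Metric.ball z₀ ε ∈ 𝓝 (c.dom z₀) := by
    refine (c.dom.contMDiffAt_symm (c.dom.map_source hz₀)).continuousAt.preimage_mem_nhds ?_
    rw [c.dom.symm_apply hz₀]
    exact Metric.ball_mem_nhds _ hε
  filter_upwards [hnhds, c.dom.open_target.mem_nhds (c.dom.map_source hz₀)] with y hy hyt hpy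
  obtain ⟨z, hz, rfl⟩ : ∃ z ∈ c.dom.source, c.dom z = y :=
    ⟨c.dom.symm y, c.dom.map_target hyt, c.dom.right_inv hyt⟩
  rw [mem_preimage, c.dom.symm_apply hz] at hy
  have hpr : c.proj z = c.proj z₀ := by
    rw [c.apply_dom z hz, c.apply_dom z₀ hz₀] at hpy
    exact c.cod.injOn (c.proj_mem z hz) (c.proj_mem z₀ hz₀) hpy
  -- the components of the form do not depend on the point of the fibre
  have hconst : ∀ u v : E', coordBilin c.dom Ω z u v = coordBilin c.dom Ω z₀ u v := by
    intro u v
    have hseg : ∀ t ∈ Icc (0 : ℝ) 1, z₀ + t • (z - z₀) ∈ c.dom.source := by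
      intro t ht
      refine hball ((convex_ball z₀ ε).add_smul_sub_mem (Metric.mem_ball_self hε) hy ht)
    have hd : ∀ t ∈ Icc (0 : ℝ) 1, HasDerivAt
        (fun t : ℝ ↦ coordBilin c.dom Ω (z₀ + t • (z - z₀)) u v) 0 t := by
      intro t ht
      have hb := contDiffAt_coordBilin hΩ (c.dom.contMDiffAt (hseg t ht))
      have hb' : DifferentiableAt ℝ (fun y ↦ coordBilin c.dom Ω y u v) (z₀ + t • (z - z₀)) :=
        ((hb.clm_apply contDiffAt_const).clm_apply contDiffAt_const).differentiableAt (by simp)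
      have hl : HasDerivAt (fun t : ℝ ↦ z₀ + t • (z - z₀)) (z - z₀) t := by
        simpa using ((hasDerivAt_id t).smul_const (z - z₀)).const_add z₀
      have := hb'.hasFDerivAt.comp_hasDerivAt t hl
      rwa [fderiv_apply_lift_eq_zero hΩ hskew hp hker hauto c (hseg t ht) u v _
        (by rw [map_sub, hpr, sub_self])] at this
    have := constant_of_has_deriv_right_zero
      (fun t ht ↦ (hd t ht).continuousAt.continuousWithinAt)
      (fun t ht ↦ (hd t (Ico_subset_Icc_self ht)).hasDerivWithinAt) 1 (by simp)
    simpa using this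
  intro v w v' w' hv hw
  obtain ⟨v, rfl⟩ := c.exists_mfderiv_dom_eq hz v
  obtain ⟨w, rfl⟩ := c.exists_mfderiv_dom_eq hz w
  obtain ⟨v', rfl⟩ := c.exists_mfderiv_dom_eq hz₀ v'
  obtain ⟨w', rfl⟩ := c.exists_mfderiv_dom_eq hz₀ w'
  -- In the chart `dp` depends on the point only through its projection, so the comparison may take
  -- place at `z₀`.
  have hinj : ∀ a b : E', (mfderiv 𝓘(ℝ, E') 𝓘(ℝ, E'') p (c.dom z)
        (mfderiv 𝓘(ℝ, E') 𝓘(ℝ, E') c.dom z a) : E'')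
      = mfderiv 𝓘(ℝ, E') 𝓘(ℝ, E'') p (c.dom z₀) (mfderiv 𝓘(ℝ, E') 𝓘(ℝ, E') c.dom z₀ b) →
      mfderiv 𝓘(ℝ, E') 𝓘(ℝ, E'') p (c.dom z₀) (mfderiv 𝓘(ℝ, E') 𝓘(ℝ, E') c.dom z₀ a)
      = mfderiv 𝓘(ℝ, E') 𝓘(ℝ, E'') p (c.dom z₀) (mfderiv 𝓘(ℝ, E') 𝓘(ℝ, E') c.dom z₀ b) := by
    intro a b hab
    refine Eq.trans ?_ hab
    refine (c.mfderiv_apply hp.contMDiff hz₀ a).trans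
      ((c.mfderiv_apply hp.contMDiff hz a).trans ?_).symm
    rw [hpr]
  refine (hconst v w).trans ?_
  exact apply_congr_of_mfderiv_eq hskew hker (hinj _ _ hv) (hinj _ _ hw)

include hΩ hskew hp hker hauto in
-- A symmetric, transitive relation that holds between nearby points of a connected fibre holds
-- throughout it. Transitivity uses surjectivity of `dp` to find vectors at the middle point.
lemma sameDescent_of_eq (hfib : ∀ q : Q, IsPreconnected (p ⁻¹' {q})) {y y' : N}
    (h : p y = p y') : SameDescent (E'' := E'') p Ω y y' := by
  have hsymm : ∀ {a b : N}, SameDescent (E'' := E'') p Ω a b → SameDescent (E'' := E'') p Ω b a :=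
    fun h v w v' w' hv hw ↦ (h v' w' v w hv.symm hw.symm).symm
  refine (hfib (p y')).induction₂ (SameDescent (E'' := E'') p Ω) ?_ ?_ ?_ h rfl
  · intro a ha
    filter_upwards [nhdsWithin_le_nhds (eventually_sameDescent hΩ hskew hp hker hauto a),
      self_mem_nhdsWithin] with b hb hbp
    exact hsymm (hb (hbp.trans ha.symm))
  · intro a b d _ _ _ hab hbd v w v' w' hv hw
    obtain ⟨v₁, hv₁⟩ := surjective_mfderiv_of_isSubmersion hp b
      (mfderiv 𝓘(ℝ, E') 𝓘(ℝ, E'') p a v : E'')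
    obtain ⟨w₁, hw₁⟩ := surjective_mfderiv_of_isSubmersion hp b
      (mfderiv 𝓘(ℝ, E') 𝓘(ℝ, E'') p a w : E'')
    exact (hab v w v₁ w₁ hv₁.symm hw₁.symm).trans (hbd v₁ w₁ v' w' (hv₁.trans hv) (hw₁.trans hw))
  · intro a b _ _ hab
    exact hsymm hab

include hΩ hskew hp hker hauto in
/-- A form which is invariant under the vertical vector fields and vanishes on them descends to the
base of a submersion with connected fibres. -/
lemma exists_pullback_eq (hsurj : Surjective p) (hfib : ∀ q : Q, IsPreconnected (p ⁻¹' {q})) :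
    ∃ ϖ : Bilin E'' Q, pullback E' p ϖ = Ω := by
  choose s hs using hsurj
  -- Right inverses of `dp` are chosen pointwise without regularity: `SameDescent` makes the result
  -- independent of them, and smoothness comes later from local sections.
  have hR : ∀ y : N, ∃ R : E'' →L[ℝ] E', ∀ u : E'',
      (mfderiv 𝓘(ℝ, E') 𝓘(ℝ, E'') p y (R u) : E'') = u := by
    intro y
    let d : E' →L[ℝ] E'' := mfderiv 𝓘(ℝ, E') 𝓘(ℝ, E'') p y
    obtain ⟨R, hR⟩ := LinearMap.exists_rightInverse_of_surjective (d : E' →ₗ[ℝ] E'')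
      (LinearMap.range_eq_top.2 (surjective_mfderiv_of_isSubmersion hp y))
    exact ⟨LinearMap.toContinuousLinearMap R, fun u ↦ DFunLike.congr_fun hR u⟩
  choose R hR using hR
  let ΩE : N → E' →L[ℝ] E' →L[ℝ] ℝ := Ω
  refine ⟨fun q ↦ (ContinuousLinearMap.precomp ℝ (R (s q))) ∘L (ΩE (s q)) ∘L (R (s q)), ?_⟩
  funext y
  refine ContinuousLinearMap.ext fun v ↦ ContinuousLinearMap.ext fun w ↦ ?_
  exact (sameDescent_of_eq hΩ hskew hp hker hauto hfib (hs (p y)).symm v w _ _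
    (hR (s (p y)) (diff E'' E' p y v)).symm (hR (s (p y)) (diff E'' E' p y w)).symm).symm

end Descent

/-! ### Reduction at one point -/

section LinearReduction

variable {V V' V'' : Type*} [NormedAddCommGroup V] [NormedSpace ℝ V] [FiniteDimensional ℝ V]
  [NormedAddCommGroup V'] [NormedSpace ℝ V'] [FiniteDimensional ℝ V']
  [NormedAddCommGroup V''] [NormedSpace ℝ V''] [FiniteDimensional ℝ V'']
  {g : V' →L[ℝ] V' →L[ℝ] ℝ} {K : Submodule ℝ V'} {b : V' →L[ℝ] V''}
  {lam : V'' →L[ℝ] V'' →L[ℝ] ℝ}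
  (hK : NondegenerateOn g K) (hb : Surjective b)
  (hker : ∀ v, v ∈ K ↔ b v = 0) (hnd : NondegenerateOn lam ⊤)
  (hproj : ∀ v ∈ orth g K, ∀ w ∈ orth g K, g v w = lam (b v) (b w))

include hK hker hproj in
-- `hproj` needs both arguments horizontal, but the `K`-component of `w` is orthogonal to `h` and
-- killed by `b`.
lemma apply_eq_of_mem_orth {h : V'} (hh : h ∈ orth g K) (w : V') : g h w = lam (b h) (b w) := by
  obtain ⟨k, hk, hw⟩ := exists_sub_mem_orth hK w
  have h1 := hproj h hh _ hw
  rwa [map_sub, map_sub, (hker k).1 hk, hh k hk, sub_zero, sub_zero] at h1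

include hK hb hker hnd hproj in
/-- The horizontal lift of `u` is the metric dual of the pullback of the metric dual of `u`. -/
lemma mem_orth_of_apply_eq {h : V'} {u : V''} (h' : ∀ w, g h w = lam u (b w)) :
    h ∈ orth g K ∧ b h = u := by
  have hh : h ∈ orth g K := fun w hw ↦ by rw [h', (hker w).1 hw, map_zero]
  refine ⟨hh, ext_of_nondegenerateOn_top hnd fun w ↦ ?_⟩
  obtain ⟨w, rfl⟩ := hb w
  rw [← apply_eq_of_mem_orth hK hker hproj hh, h']

variable {a : V' →L[ℝ] V} {ω γ : V →L[ℝ] V →L[ℝ] ℝ} {A : V →L[ℝ] V}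
  {ϖ : V'' →L[ℝ] V'' →L[ℝ] ℝ} {J' : V'' →L[ℝ] V''}
  (hω : NondegenerateOn ω ⊤) (halt : ∀ v w, ω v w = - ω w v) (hsymm : ∀ v w, γ v w = γ w v)
  (hg : ∀ v w, g v w = γ (a v) (a w)) (hA : ∀ v w, ω (A v) w = γ v w)
  (horth : orth γ ((orth g K).map (a : V' →ₗ[ℝ] V)) = orth ω ((orth g K).map (a : V' →ₗ[ℝ] V)))
  (hϖ : NondegenerateOn ϖ ⊤) (hωϖ : ∀ v w, ω (a v) (a w) = ϖ (b v) (b w))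
  (hJ' : ∀ u w, ϖ (J' u) w = lam u w)

include hK hb hker hproj hω halt hsymm hg hA horth hϖ hωϖ hJ' in
/-- The structure endomorphism preserves the horizontal subspace and induces there the structure
endomorphism of the quotient. -/
lemma exists_lift_endo {h : V'} (hh : h ∈ orth g K) :
    ∃ h' ∈ orth g K, A (a h) = a h' ∧ b h' = J' (b h) := by
  -- The condition `K'^{⊥γ} = K'^{⊥ω}` acts here: a vector `ω`-orthogonal to `K'` is `γ`-orthogonal
  -- to `a h`, hence `ω`-orthogonal to `A (a h)`.
  obtain ⟨h', hh', e⟩ : A (a h) ∈ (orth g K).map (a : V' →ₗ[ℝ] V) := by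
    refine mem_of_orth_orth hω halt fun u hu ↦ ?_
    rw [← horth] at hu
    rw [hA, hsymm]
    exact hu _ ⟨h, hh, rfl⟩
  have e' : A (a h) = a h' := e.symm
  refine ⟨h', hh', e', ext_of_nondegenerateOn_top hϖ fun w ↦ ?_⟩
  obtain ⟨w, rfl⟩ := hb w
  rw [hJ', ← hωϖ, ← e', hA, ← hg, apply_eq_of_mem_orth hK hker hproj hh]

include hK hb hker hproj hω halt hsymm hg hA horth hϖ hωϖ hJ' in
-- Evaluation on a horizontal lift of `u`, which `A` sends to a lift of `J' u`. The scalar `ε`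
-- covers both signs at once.
lemma apply_endo_quotient {ε : ℝ} (hε : ∀ v w, γ (A v) w = ε * ω v w) (u w : V'') :
    lam (J' u) w = ε * ϖ u w := by
  obtain ⟨h, hh, rfl⟩ := exists_horizontalLift hK hb hker u
  obtain ⟨w, rfl⟩ := hb w
  obtain ⟨h', hh', e, e'⟩ :=
    exists_lift_endo hK hb hker hproj hω halt hsymm hg hA horth hϖ hωϖ hJ' hh
  rw [← e', ← apply_eq_of_mem_orth hK hker hproj hh', hg, ← e, hε, hωϖ]

end LinearReduction

/-! ### The reduced form on `Q` -/

section Reduction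

variable {E : Type*} [NormedAddCommGroup E] [NormedSpace ℝ E] [FiniteDimensional ℝ E]
  {M : Type*} [TopologicalSpace M] [ChartedSpace E M] [IsManifold 𝓘(ℝ, E) ∞ M]
  {E' : Type*} [NormedAddCommGroup E'] [NormedSpace ℝ E'] [FiniteDimensional ℝ E']
  {E'' : Type*} [NormedAddCommGroup E''] [NormedSpace ℝ E''] [FiniteDimensional ℝ E'']
  {N : Type*} [TopologicalSpace N] [ChartedSpace E' N] [IsManifold 𝓘(ℝ, E') ∞ N]
  {Q : Type*} [TopologicalSpace Q] [ChartedSpace E'' Q] [IsManifold 𝓘(ℝ, E'') ∞ Q]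
  {ω γ : Bilin E M} {ι : N → M} {p : N → Q} {r : ℕ} {lam ϖ : Bilin E'' Q}

lemma pullback_apply (f : N → M) (B : Bilin E M) (y : N) (v w : TangentSpace 𝓘(ℝ, E') y) :
    pullback E' f B y v w = B (f y) (mfderiv 𝓘(ℝ, E') 𝓘(ℝ, E) f y v)
      (mfderiv 𝓘(ℝ, E') 𝓘(ℝ, E) f y w) := rfl

lemma mem_distK {y : N} {v : TangentSpace 𝓘(ℝ, E') y} :
    v ∈ distK E' ω ι y ↔ ∀ w, pullback E' ι ω y v w = 0 := by
  constructor
  · exact fun h w ↦ h _ ⟨w, rfl⟩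
  · rintro h _ ⟨w, rfl⟩
    exact h w

lemma distK'_eq (y : N) :
    distK' E' ω γ ι y = orth (pullback E' ι γ y) (distK E' ω ι y) := by
  ext v
  constructor
  · exact fun h w hw ↦ h _ ⟨w, hw, rfl⟩
  · rintro h _ ⟨w, hw, rfl⟩
    exact h w hw

lemma smoothBilin_pullback {B : Bilin E M} (hB : SmoothBilin B)
    (hι : ContMDiff 𝓘(ℝ, E') 𝓘(ℝ, E) ∞ ι) : SmoothBilin (pullback E' ι B) :=
  smoothBilin_of_apply fun x₀ _ _ hX hY ↦ hB.contMDiffAt_apply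
    (contMDiffAt_mfderiv_apply (hι x₀) hX) (contMDiffAt_mfderiv_apply (hι x₀) hY)

/-- The differential of a map in terms of its expression in a parametrization. -/
lemma Param.mfderiv_fderiv_symm_comp (Φ : Param E E M) {f : E' → M} {t : E'}
    (hf : MDifferentiableAt 𝓘(ℝ, E') 𝓘(ℝ, E) f t) (ht : f t ∈ Φ.target) (u : E') :
    (mfderiv 𝓘(ℝ, E) 𝓘(ℝ, E) Φ (Φ.symm (f t)) (fderiv ℝ (Φ.symm ∘ f) t u) : E)
      = mfderiv 𝓘(ℝ, E') 𝓘(ℝ, E) f t u := by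
  have hF := (Φ.mdiffAt_symm ht).comp t hf
  have h1 := mfderiv_comp t (Φ.mdiffAt (z := (Φ.symm ∘ f) t) (Φ.map_target ht)) hF
  have h2 : Φ ∘ Φ.symm ∘ f =ᶠ[𝓝 t] f := by
    filter_upwards [hf.continuousAt.preimage_mem_nhds (Φ.open_target.mem_nhds ht)] with x hx
    exact Φ.apply_symm hx
  rw [mfderiv_eq_fderiv] at h1
  exact DFunLike.congr_fun (h1.symm.trans h2.mfderiv_eq) u

lemma Param.coordBilin_symm_comp (Φ : Param E E M) {f : E' → M} {t : E'}
    (hf : MDifferentiableAt 𝓘(ℝ, E') 𝓘(ℝ, E) f t) (ht : f t ∈ Φ.target) (B : Bilin E M)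
    (u v : E') : coordBilin Φ B (Φ.symm (f t)) (fderiv ℝ (Φ.symm ∘ f) t u)
      (fderiv ℝ (Φ.symm ∘ f) t v) = coordBilin f B t u v := by
  -- With tangent spaces unfolded to the model space, the base point can be rewritten without
  -- affecting the types of the vectors.
  let B' : M → E →L[ℝ] E →L[ℝ] ℝ := B
  change B' (Φ (Φ.symm (f t))) (mfderiv 𝓘(ℝ, E) 𝓘(ℝ, E) Φ (Φ.symm (f t)) _)
    (mfderiv 𝓘(ℝ, E) 𝓘(ℝ, E) Φ (Φ.symm (f t)) _) = B' (f t) _ _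
  rw [Φ.apply_symm ht]
  exact congrArg₂ (fun a b ↦ B' (f t) a b) (Φ.mfderiv_fderiv_symm_comp hf ht u)
    (Φ.mfderiv_fderiv_symm_comp hf ht v)

namespace IsSymplecticReduction

variable (hred : IsSymplecticReduction E' E'' ω ι p r)

include hred

lemma contMDiff_ι : ContMDiff 𝓘(ℝ, E') 𝓘(ℝ, E) ∞ ι := hred.immersion.contMDiff

lemma contMDiff_p : ContMDiff 𝓘(ℝ, E') 𝓘(ℝ, E'') ∞ p := hred.submersion.contMDiff

lemma surjective_mfderiv (y : N) : Surjective (mfderiv 𝓘(ℝ, E') 𝓘(ℝ, E'') p y) :=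
  surjective_mfderiv_of_isSubmersion hred.submersion y

/-- `K` is spanned by fields tangent to the leaves, on which `p` is constant; equality follows since
`ι^*ω` and `dp` both have rank `2r`. -/
lemma distK_eq_ker (y : N) : distK E' ω ι y = LinearMap.ker (diffₗ E'' E' p y) := by
  have hle : distK E' ω ι y ≤ LinearMap.ker (diffₗ E'' E' p y) := by
    obtain ⟨U, hU, hyU, k, X, hX, -, hspan⟩ := hred.automorphisms y
    rw [hspan y hyU, Submodule.span_le]
    rintro _ ⟨i, rfl⟩
    refine mfderiv_eq_zero_of_sameLeaf hred.contMDiff_p hred.constant_on_leaves hU (hX i)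
      (fun z hz ↦ ?_) hyU
    rw [hspan z hz]
    exact Submodule.subset_span ⟨i, rfl⟩
  let L : E' →ₗ[ℝ] E' →L[ℝ] ℝ := (pullback E' ι ω y :
    TangentSpace 𝓘(ℝ, E') y →ₗ[ℝ] TangentSpace 𝓘(ℝ, E') y →L[ℝ] ℝ)
  let P : E' →ₗ[ℝ] E'' := diffₗ E'' E' p y
  have h1 : Module.finrank ℝ (LinearMap.range L) + Module.finrank ℝ (LinearMap.ker L)
    = Module.finrank ℝ E' := L.finrank_range_add_finrank_ker
  have h2 : Module.finrank ℝ (LinearMap.range P) + Module.finrank ℝ (LinearMap.ker P)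
    = Module.finrank ℝ E' := P.finrank_range_add_finrank_ker
  have h3 : Module.finrank ℝ (LinearMap.range L) = 2 * r := hred.constant_rank y
  have h4 : Module.finrank ℝ (LinearMap.range P) = 2 * r := by
    have : LinearMap.range P = ⊤ := LinearMap.range_eq_top.2 (hred.surjective_mfderiv y)
    rw [this, finrank_top, hred.dim_quotient]
  have h5 : (distK E' ω ι y : Submodule ℝ E') = LinearMap.ker L := by
    ext v
    refine mem_distK.trans ?_
    exact (show _ ↔ L v = 0 from
      ⟨fun h ↦ ContinuousLinearMap.ext h, fun h w ↦ DFunLike.congr_fun h w⟩).trans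
      LinearMap.mem_ker.symm
  refine Submodule.eq_of_le_of_finrank_eq (V := E') (S₂ := LinearMap.ker P) hle ?_
  have h6 : Module.finrank ℝ (LinearMap.ker L) = Module.finrank ℝ (LinearMap.ker P) := by omega
  exact (congrArg (fun S : Submodule ℝ E' ↦ Module.finrank ℝ S) h5).trans h6

lemma mem_distK_iff {y : N} {v : TangentSpace 𝓘(ℝ, E') y} :
    v ∈ distK E' ω ι y ↔ mfderiv 𝓘(ℝ, E') 𝓘(ℝ, E'') p y v = 0 := by
  rw [hred.distK_eq_ker, LinearMap.mem_ker]
  rfl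

lemma exists_reducedForm (hω : IsAlmostSymplectic ω) :
    ∃ ϖ : Bilin E'' Q, pullback E' p ϖ = pullback E' ι ω := by
  refine exists_pullback_eq (smoothBilin_pullback hω.smooth hred.contMDiff_ι)
    (fun y v w ↦ skew_of_alternating hω.alternating _ _ _) hred.submersion
    (fun y v ↦ hred.mem_distK_iff.symm.trans mem_distK) (fun y ↦ ?_) hred.surjective
    hred.connected_fibres
  obtain ⟨U, hU, hyU, k, X, hX, hXa, hspan⟩ := hred.automorphisms y
  refine ⟨U, hU, hyU, k, X, hX, hXa, fun i z hz ↦ hred.mem_distK_iff.1 ?_, fun z hz v hv ↦ ?_⟩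
  · rw [hspan z hz]
    exact Submodule.subset_span ⟨i, rfl⟩
  · rw [← hspan z hz]
    exact hred.mem_distK_iff.2 hv

lemma pullback_injective {ϖ ϖ' : Bilin E'' Q} (h : pullback E' p ϖ = pullback E' p ϖ') :
    ϖ = ϖ' := by
  funext q
  obtain ⟨y, rfl⟩ := hred.surjective q
  refine ContinuousLinearMap.ext fun u ↦ ContinuousLinearMap.ext fun w ↦ ?_
  obtain ⟨u, rfl⟩ := hred.surjective_mfderiv y u
  obtain ⟨w, rfl⟩ := hred.surjective_mfderiv y w
  exact congrArg (fun B : Bilin E' N ↦ B y u w) h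

variable (hϖ : pullback E' p ϖ = pullback E' ι ω)

include hϖ

lemma apply_mfderiv (y : N) (v w : TangentSpace 𝓘(ℝ, E') y) :
    ϖ (p y) (mfderiv 𝓘(ℝ, E') 𝓘(ℝ, E'') p y v) (mfderiv 𝓘(ℝ, E') 𝓘(ℝ, E'') p y w)
      = ω (ι y) (mfderiv 𝓘(ℝ, E') 𝓘(ℝ, E) ι y v) (mfderiv 𝓘(ℝ, E') 𝓘(ℝ, E) ι y w) :=
  congrArg (fun B : Bilin E' N ↦ B y v w) hϖ

/-- As `dp ∘ ds = 1`, the differential of a section supplies lifts, so locally the reduced form is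
an honest pullback from `M` by a smooth map. -/
lemma apply_section {s : Q → N} {V : Set Q} (hV : IsOpen V)
    (hs : ContMDiffOn 𝓘(ℝ, E'') 𝓘(ℝ, E') ∞ s V) (hps : ∀ q ∈ V, p (s q) = q) {q : Q} (hq : q ∈ V)
    (u w : TangentSpace 𝓘(ℝ, E'') q) : ϖ q u w = pullback E'' (ι ∘ s) ω q u w := by
  have hsq := hs.contMDiffAt (hV.mem_nhds hq)
  have h1 := mfderiv_comp q ((hred.contMDiff_p (s q)).mdifferentiableAt (by simp))
    (hsq.mdifferentiableAt (by simp))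
  have h2 : p ∘ s =ᶠ[𝓝 q] id := by
    filter_upwards [hV.mem_nhds hq] with x hx using hps x hx
  rw [h2.mfderiv_eq, mfderiv_id] at h1
  have h3 := mfderiv_comp q ((hred.contMDiff_ι (s q)).mdifferentiableAt (by simp))
    (hsq.mdifferentiableAt (by simp))
  rw [pullback_apply, h3]
  refine Eq.trans ?_ (hred.apply_mfderiv hϖ (s q) (mfderiv 𝓘(ℝ, E'') 𝓘(ℝ, E') s q u)
    (mfderiv 𝓘(ℝ, E'') 𝓘(ℝ, E') s q w))
  have hu : u = _ := DFunLike.congr_fun h1 u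
  have hw : w = _ := DFunLike.congr_fun h1 w
  let ϖE : Q → E'' →L[ℝ] E'' →L[ℝ] ℝ := ϖ
  change ϖE q u w = ϖE (p (s q)) _ _
  rw [hps q hq]
  exact congrArg₂ (fun a b ↦ ϖE q a b) hu hw

/-- Smoothness is read off along local sections. A lift of a vector in the radical of `ϖ` lies in
the radical `K` of `ι^*ω`, which `dp` kills. -/
lemma isAlmostSymplectic (hω : IsAlmostSymplectic ω) : IsAlmostSymplectic ϖ where
  smooth := by
    refine smoothBilin_of_apply fun q X Y hX hY ↦ ?_
    obtain ⟨y, rfl⟩ := hred.surjective q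
    obtain ⟨s, V, hV, hyV, hs, hps⟩ := exists_section hred.submersion y
    have hf : ContMDiffAt 𝓘(ℝ, E'') 𝓘(ℝ, E) ∞ (ι ∘ s) (p y) :=
      (hred.contMDiff_ι _).comp _ (hs.contMDiffAt (hV.mem_nhds hyV))
    refine (hω.smooth.contMDiffAt_apply (contMDiffAt_mfderiv_apply hf hX)
      (contMDiffAt_mfderiv_apply hf hY)).congr_of_eventuallyEq ?_
    filter_upwards [hV.mem_nhds hyV] with q hq
    exact hred.apply_section hϖ hV hs hps hq _ _
  alternating q u := by
    obtain ⟨y, rfl⟩ := hred.surjective q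
    obtain ⟨u, rfl⟩ := hred.surjective_mfderiv y u
    rw [hred.apply_mfderiv hϖ, hω.alternating]
  nondegenerate q u _ hu := by
    obtain ⟨y, rfl⟩ := hred.surjective q
    obtain ⟨u, rfl⟩ := hred.surjective_mfderiv y u
    refine hred.mem_distK_iff.1 (mem_distK.2 fun w ↦ ?_)
    exact (hred.apply_mfderiv hϖ y u w).symm.trans (hu _ trivial)

lemma isClosedForm (hω : IsAlmostSymplectic ω) (hd : IsClosedForm ω) : IsClosedForm ϖ := by
  have hs' := hred.isAlmostSymplectic hϖ hω
  refine isClosedForm_of_extDerivative hs'.smooth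
    (fun x v w ↦ skew_of_alternating hs'.alternating _ _ _) fun q ↦ ?_
  obtain ⟨y, rfl⟩ := hred.surjective q
  obtain ⟨s, V, hV, hyV, hs, hps⟩ := exists_section hred.submersion y
  obtain ⟨κ, z, hz, hzy⟩ := exists_param (E := E'') (p y)
  obtain ⟨Φ, x, hx, hxy⟩ := exists_param (E := E) (ι (s (p y)))
  refine ⟨κ, z, hz, hzy, ?_⟩
  have hzV : κ z ∈ V := hzy ▸ hyV
  have hκ := κ.contMDiffAt hz
  have hf : ContMDiffAt 𝓘(ℝ, E'') 𝓘(ℝ, E) ∞ ((ι ∘ s) ∘ κ) z :=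
    ((hred.contMDiff_ι _).comp _ (hs.contMDiffAt (hV.mem_nhds hzV))).comp z hκ
  have hfz : ((ι ∘ s) ∘ κ) z = Φ x := by
    simp [hzy, hxy]
  have hmem : ((ι ∘ s) ∘ κ) z ∈ Φ.target := hfz ▸ Φ.map_source hx
  have hF : ContMDiffAt 𝓘(ℝ, E'') 𝓘(ℝ, E) ∞ (Φ.symm ∘ (ι ∘ s) ∘ κ) z :=
    (Φ.contMDiffAt_symm hmem).comp z hf
  have hFz : (Φ.symm ∘ (ι ∘ s) ∘ κ) z = x := by
    rw [Function.comp_apply, hfz, Φ.symm_apply hx]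
  have hxs : (Φ.symm ∘ (ι ∘ s) ∘ κ) z ∈ Φ.source := hFz ▸ hx
  intro u v w
  refine extDerivative_pullback (b := coordBilin Φ ω) hF.contDiffAt
    ((contDiffAt_coordBilin hω.smooth (Φ.contMDiffAt hxs)).differentiableAt (by simp))
    (fun a b ↦ skew_of_alternating hω.alternating _ _ _) ?_
    ((contDiffAt_coordBilin hs'.smooth hκ).differentiableAt (by simp))
    (fun a b c ↦ hd.extDerivative_coordBilin Φ hω.smooth hxs a b c) u v w
  filter_upwards [κ.open_source.mem_nhds hz, hκ.continuousAt.preimage_mem_nhds (hV.mem_nhds hzV),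
    hf.continuousAt.preimage_mem_nhds (Φ.open_target.mem_nhds hmem)] with t ht htV htΦ u v
  have hst := ((hred.contMDiff_ι _).comp _ (hs.contMDiffAt (hV.mem_nhds htV))).mdifferentiableAt
    (n := ∞) (by simp)
  rw [coordBilin_apply, hred.apply_section hϖ hV hs hps htV]
  refine Eq.trans ?_ (Φ.coordBilin_symm_comp (hst.comp t (κ.mdiffAt ht)) htΦ ω u v).symm
  rw [coordBilin_apply, mfderiv_comp t hst (κ.mdiffAt ht)]
  rfl

end IsSymplecticReduction

end Reduction

/-! ### The reduced metric and endomorphism on `Q` -/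

section MetricReduction

variable {E : Type*} [NormedAddCommGroup E] [NormedSpace ℝ E] [FiniteDimensional ℝ E]
  {M : Type*} [TopologicalSpace M] [ChartedSpace E M] [IsManifold 𝓘(ℝ, E) ∞ M]
  {E' : Type*} [NormedAddCommGroup E'] [NormedSpace ℝ E'] [FiniteDimensional ℝ E']
  {E'' : Type*} [NormedAddCommGroup E''] [NormedSpace ℝ E''] [FiniteDimensional ℝ E'']
  {N : Type*} [TopologicalSpace N] [ChartedSpace E' N] [IsManifold 𝓘(ℝ, E') ∞ N]
  {Q : Type*} [TopologicalSpace Q] [ChartedSpace E'' Q] [IsManifold 𝓘(ℝ, E'') ∞ Q]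
  {ω γ : Bilin E M} {ι : N → M} {p : N → Q} {r : ℕ} {lam ϖ : Bilin E'' Q}

namespace IsMetricReduction

variable (hmet : IsMetricReduction E' ω γ ι p lam) (hred : IsSymplecticReduction E' E'' ω ι p r)

include hmet

lemma pullback_apply_of_mem_orth {y : N} {v w : TangentSpace 𝓘(ℝ, E') y}
    (hv : v ∈ orth (pullback E' ι γ y) (distK E' ω ι y))
    (hw : w ∈ orth (pullback E' ι γ y) (distK E' ω ι y)) :
    pullback E' ι γ y v w
      = lam (p y) (mfderiv 𝓘(ℝ, E') 𝓘(ℝ, E'') p y v) (mfderiv 𝓘(ℝ, E') 𝓘(ℝ, E'') p y w) := by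
  rw [← distK'_eq] at hv hw
  exact hmet.projects y v hv w hw

include hred

lemma apply_eq_of_mem_orth {y : N} {h : TangentSpace 𝓘(ℝ, E') y}
    (hh : h ∈ orth (pullback E' ι γ y) (distK E' ω ι y)) (w : TangentSpace 𝓘(ℝ, E') y) :
    pullback E' ι γ y h w
      = lam (p y) (mfderiv 𝓘(ℝ, E') 𝓘(ℝ, E'') p y h) (mfderiv 𝓘(ℝ, E') 𝓘(ℝ, E'') p y w) :=
  SymplecticReduction.apply_eq_of_mem_orth (V' := E') (V'' := E'') (hmet.nondegenerate_K y)
    (fun _ ↦ hred.mem_distK_iff) (fun _ hv _ hw ↦ hmet.pullback_apply_of_mem_orth hv hw) hh w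

lemma mem_orth_of_apply_eq (hlam : IsPseudoMetric lam) {y : N} {h : TangentSpace 𝓘(ℝ, E') y}
    {u : TangentSpace 𝓘(ℝ, E'') (p y)} (h' : ∀ w, pullback E' ι γ y h w
      = lam (p y) u (mfderiv 𝓘(ℝ, E') 𝓘(ℝ, E'') p y w)) :
    h ∈ orth (pullback E' ι γ y) (distK E' ω ι y) ∧ mfderiv 𝓘(ℝ, E') 𝓘(ℝ, E'') p y h = u :=
  SymplecticReduction.mem_orth_of_apply_eq (V' := E') (V'' := E'') (hmet.nondegenerate_K y)
    (hred.surjective_mfderiv y) (fun _ ↦ hred.mem_distK_iff) (hlam.nondegenerate _)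
    (fun _ hv _ hw ↦ hmet.pullback_apply_of_mem_orth hv hw) h'

lemma exists_lift (y : N) (u : TangentSpace 𝓘(ℝ, E'') (p y)) :
    ∃ h ∈ orth (pullback E' ι γ y) (distK E' ω ι y), mfderiv 𝓘(ℝ, E') 𝓘(ℝ, E'') p y h = u :=
  exists_horizontalLift (V' := E') (V'' := E'') (hmet.nondegenerate_K y)
    (hred.surjective_mfderiv y) (fun _ ↦ hred.mem_distK_iff) u

lemma positiveDefinite (hpos : PositiveDefinite γ) : PositiveDefinite lam := by
  intro q u hu
  obtain ⟨y, rfl⟩ := hred.surjective q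
  obtain ⟨h, hh, rfl⟩ := hmet.exists_lift hred y u
  rw [← hmet.apply_eq_of_mem_orth hred hh]
  refine hpos _ _ fun h0 ↦ hu ?_
  -- A vector killed by `dι` lies in the radical of `ι^*γ`, which is zero.
  have : h = 0 := hmet.nondegenerate_N y h trivial fun w _ ↦ by
    rw [pullback_apply]
    exact (congrArg (fun v ↦ γ (ι y) v _) h0).trans (by simp)
  rw [this, map_zero]

variable (hω : IsAlmostSymplectic ω) (hγ : IsPseudoMetric γ) (hlam : IsPseudoMetric lam)
  (horth : OrthCondition E' ω γ ι) (hϖ : pullback E' p ϖ = pullback E' ι ω)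

include hω hγ horth hϖ

lemma exists_lift_structureEndo {y : N} {h : TangentSpace 𝓘(ℝ, E') y}
    (hh : h ∈ orth (pullback E' ι γ y) (distK E' ω ι y)) :
    ∃ h' ∈ orth (pullback E' ι γ y) (distK E' ω ι y),
      structureEndo ω γ (ι y) (mfderiv 𝓘(ℝ, E') 𝓘(ℝ, E) ι y h)
        = mfderiv 𝓘(ℝ, E') 𝓘(ℝ, E) ι y h' ∧
      mfderiv 𝓘(ℝ, E') 𝓘(ℝ, E'') p y h'
        = structureEndo ϖ lam (p y) (mfderiv 𝓘(ℝ, E') 𝓘(ℝ, E'') p y h) := by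
  have hϖ' := (hred.isAlmostSymplectic hϖ hω).nondegenerate
  have ho := horth y
  rw [distK'_eq] at ho
  exact exists_lift_endo (V := E) (V' := E') (V'' := E'') (hmet.nondegenerate_K y)
    (hred.surjective_mfderiv y) (fun _ ↦ hred.mem_distK_iff)
    (fun _ hv _ hw ↦ hmet.pullback_apply_of_mem_orth hv hw) (hω.nondegenerate (ι y))
    (fun v w ↦ skew_of_alternating hω.alternating _ _ _) (hγ.symm (ι y)) (fun _ _ ↦ rfl)
    (apply_structureEndo hω.nondegenerate γ (ι y)) ho (hϖ' (p y))
    (fun v w ↦ (hred.apply_mfderiv hϖ y v w).symm) (apply_structureEndo hϖ' lam (p y)) hh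

lemma apply_structureEndo {ε : ℝ} (hε : ∀ x v w, γ x (structureEndo ω γ x v) w = ε * ω x v w)
    (q : Q) (u w : TangentSpace 𝓘(ℝ, E'') q) :
    lam q (structureEndo ϖ lam q u) w = ε * ϖ q u w := by
  obtain ⟨y, rfl⟩ := hred.surjective q
  have hϖ' := (hred.isAlmostSymplectic hϖ hω).nondegenerate
  have ho := horth y
  rw [distK'_eq] at ho
  exact apply_endo_quotient (V := E) (V' := E') (V'' := E'') (hmet.nondegenerate_K y)
    (hred.surjective_mfderiv y) (fun _ ↦ hred.mem_distK_iff)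
    (fun _ hv _ hw ↦ hmet.pullback_apply_of_mem_orth hv hw) (hω.nondegenerate (ι y))
    (fun v w ↦ skew_of_alternating hω.alternating _ _ _) (hγ.symm (ι y)) (fun _ _ ↦ rfl)
    (SymplecticReduction.apply_structureEndo hω.nondegenerate γ (ι y)) ho (hϖ' (p y))
    (fun v w ↦ (hred.apply_mfderiv hϖ y v w).symm)
    (SymplecticReduction.apply_structureEndo hϖ' lam (p y)) (hε (ι y)) u w

include hlam

lemma nijenhuisVanishes {ε : ℝ} (hε : ∀ x v w, γ x (structureEndo ω γ x v) w = ε * ω x v w)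
    (hN : NijenhuisVanishes (structureEndo ω γ)) : NijenhuisVanishes (structureEndo ϖ lam) := by
  have hϖ' := hred.isAlmostSymplectic hϖ hω
  have hA := smoothEndo_structureEndo hω.smooth hω.nondegenerate hγ.smooth
  have hA' := smoothEndo_structureEndo hϖ'.smooth hϖ'.nondegenerate hlam.smooth
  have hι := hred.contMDiff_ι
  have hg := smoothBilin_pullback hγ.smooth hι
  refine nijenhuisVanishes_of_coordNijenhuis hA' fun q ↦ ?_
  obtain ⟨y₀, rfl⟩ := hred.surjective q
  obtain ⟨c, z, hz, rfl⟩ := exists_submersionChart hred.submersion y₀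
  refine ⟨c.cod, c.proj z, c.proj_mem z hz, (c.apply_dom z hz).symm, fun u v ↦ ?_⟩
  obtain ⟨Φ, x, hx, hxy⟩ := exists_param (E := E) (ι (c.dom z))
  let f : E' → M := ι ∘ c.dom
  let g : E' → E' →L[ℝ] E' →L[ℝ] ℝ := coordBilin c.dom (pullback E' ι γ)
  let l : E'' → E'' →L[ℝ] E'' →L[ℝ] ℝ := coordBilin c.cod lam
  -- The horizontal lift as a metric dual, `g(H u, w) = λ(u, proj w)`; its smoothness follows from
  -- that of inversion.
  let H : E' → E'' →L[ℝ] E' := fun y ↦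
    (g y).inverse ∘L (ContinuousLinearMap.precomp ℝ c.proj) ∘L (l (c.proj y))
  have hf : ∀ {t}, t ∈ c.dom.source → ContMDiffAt 𝓘(ℝ, E') 𝓘(ℝ, E) ∞ f t := fun ht ↦
    (hι _).comp _ (c.dom.contMDiffAt ht)
  have hfd : ∀ {t}, t ∈ c.dom.source → MDifferentiableAt 𝓘(ℝ, E') 𝓘(ℝ, E) f t := fun ht ↦
    (hf ht).mdifferentiableAt (by simp)
  have hgnd : ∀ {t}, t ∈ c.dom.source → NondegenerateOn (g t) ⊤ := fun ht ↦
    c.dom.nondegenerateOn_coordBilin ht hmet.nondegenerate_N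
  have hH : ∀ {t}, t ∈ c.dom.source → ∀ u w, g t (H t u) w = l (c.proj t) u (c.proj w) := by
    intro t ht u w
    exact DFunLike.congr_fun (apply_inverse_of_nondegenerateOn_top (hgnd ht) _) w
  -- the lift `H` is horizontal
  have hH' : ∀ {t}, t ∈ c.dom.source → ∀ u w,
      pullback E' ι γ (c.dom t) (mfderiv 𝓘(ℝ, E') 𝓘(ℝ, E') c.dom t (H t u)) w
      = lam (p (c.dom t)) (mfderiv 𝓘(ℝ, E'') 𝓘(ℝ, E'') c.cod (c.proj t) u : E'')
        (mfderiv 𝓘(ℝ, E') 𝓘(ℝ, E'') p (c.dom t) w) := by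
    intro t ht u w
    obtain ⟨w, rfl⟩ := c.exists_mfderiv_dom_eq ht w
    refine (hH ht u w).trans ?_
    let lE : Q → E'' →L[ℝ] E'' →L[ℝ] ℝ := lam
    change lE (c.cod (c.proj t)) _ _ = lE (p (c.dom t)) _ _
    rw [c.apply_dom t ht]
    exact congrArg _ (c.mfderiv_apply hred.contMDiff_p ht w).symm
  have hHmem := fun {t} (ht : t ∈ c.dom.source) u ↦ hmet.mem_orth_of_apply_eq hred hlam (hH' ht u)
  have hpr : ∀ {t}, t ∈ c.dom.source → ∀ u, c.proj (H t u) = u := by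
    intro t ht u
    refine (c.cod.deriv (c.proj_mem t ht)).injective ?_
    exact (c.mfderiv_apply hred.contMDiff_p ht _).symm.trans (hHmem ht u).2
  have hdf : ∀ {t}, t ∈ c.dom.source → ∀ u, (mfderiv 𝓘(ℝ, E') 𝓘(ℝ, E) f t u : E)
      = mfderiv 𝓘(ℝ, E') 𝓘(ℝ, E) ι (c.dom t) (mfderiv 𝓘(ℝ, E') 𝓘(ℝ, E') c.dom t u) :=
    fun {t} ht u ↦ DFunLike.congr_fun
      (mfderiv_comp t ((hι _).mdifferentiableAt (by simp)) (c.dom.mdiffAt ht)) u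
  have hgf : ∀ {t}, t ∈ c.dom.source → f t ∈ Φ.target → ∀ u v,
      coordBilin Φ γ (Φ.symm (f t)) (fderiv ℝ (Φ.symm ∘ f) t u) (fderiv ℝ (Φ.symm ∘ f) t v)
        = g t u v := by
    intro t ht htΦ u v
    refine (Φ.coordBilin_symm_comp (hfd ht) htΦ γ u v).trans ?_
    exact congrArg₂ (fun a b ↦ γ (f t) a b) (hdf ht u) (hdf ht v)
  have hzΦ : f z ∈ Φ.target := by
    change ι (c.dom z) ∈ _
    rw [← hxy]
    exact Φ.map_source hx
  have hxz : Φ.symm (f z) ∈ Φ.source := Φ.map_target hzΦ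
  refine coordNijenhuis_descend (ι := Φ.symm ∘ f) (H := H) (J := Φ.coordEndo (structureEndo ω γ))
    (γ := coordBilin Φ γ (Φ.symm (f z))) (ε := -1)
    ((Φ.contMDiffAt_symm hzΦ).comp z (hf hz)).contDiffAt ?_
    ((Φ.contDiffAt_coordEndo hA hxz).differentiableAt (by simp))
    ((c.cod.contDiffAt_coordEndo hA' (c.proj_mem z hz)).differentiableAt (by simp)) ?_ ?_ ?_ ?_ ?_
    (fun a b ↦ hN.coordNijenhuis Φ hA hxz a b) u v
  · have h1 := contDiffAt_inverse_of_nondegenerateOn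
      (contDiffAt_coordBilin hg (c.dom.contMDiffAt hz)) (hgnd hz)
    have h2 : ContDiffAt ℝ ∞ l (c.proj z) :=
      contDiffAt_coordBilin hlam.smooth (c.cod.contMDiffAt (c.proj_mem z hz))
    exact (h1.clm_comp (contDiffAt_const.clm_comp
      (h2.comp z c.proj.contDiff.contDiffAt))).differentiableAt (by simp)
  · filter_upwards [c.dom.open_source.mem_nhds hz] with t ht using hpr ht
  · filter_upwards [c.dom.open_source.mem_nhds hz,
      (hf hz).continuousAt.preimage_mem_nhds (Φ.open_target.mem_nhds hzΦ)] with t ht htΦ u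
    have hxt : Φ.symm (f t) ∈ Φ.source := Φ.map_target htΦ
    refine (Φ.deriv hxt).injective ?_
    obtain ⟨h', hh', e, e'⟩ :=
      hmet.exists_lift_structureEndo hred hω hγ horth hϖ (hHmem ht u).1
    -- A horizontal vector is determined by its projection, since the projection fixes its pairing
    -- with every `w`.
    have h1 : h' = mfderiv 𝓘(ℝ, E') 𝓘(ℝ, E') c.dom t
        (H t (c.cod.coordEndo (structureEndo ϖ lam) (c.proj t) u)) := by
      refine hmet.nondegenerate_N.ext fun w ↦ ?_
      rw [hmet.apply_eq_of_mem_orth hred hh', hH' ht, e', (hHmem ht u).2]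
      refine congrArg (fun a ↦ lam (p (c.dom t)) a _) ?_
      let A' : Q → E'' →L[ℝ] E'' := structureEndo ϖ lam
      refine Eq.trans ?_ (c.cod.mfderiv_coordEndo (c.proj_mem t ht) (structureEndo ϖ lam) u).symm
      change A' (p (c.dom t)) _ = A' (c.cod (c.proj t)) _
      rw [c.apply_dom t ht]
    let A : M → E →L[ℝ] E := structureEndo ω γ
    refine (Φ.mfderiv_coordEndo hxt (structureEndo ω γ) _).trans ?_
    refine Eq.trans ?_ (Φ.mfderiv_fderiv_symm_comp (hfd ht) htΦ _).symm
    refine Eq.trans ?_ (hdf ht _).symm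
    change A (Φ (Φ.symm (f t))) _ = _
    rw [Φ.apply_symm htΦ]
    refine (congrArg (A (f t)) ((Φ.mfderiv_fderiv_symm_comp (hfd ht) htΦ _).trans
      (hdf ht _))).trans (e.trans ?_)
    rw [h1]
  · intro k hk u
    refine (hgf hz hzΦ k (H z u)).trans ?_
    have := (hHmem hz u).1 _ (hred.mem_distK_iff.2
      ((c.mfderiv_eq_zero_iff hred.contMDiff_p hz k).2 hk))
    exact (hγ.symm _ _ _).trans this
  · intro a b
    -- The endomorphism is `γ`-skew whatever `ε` is, because `ω` is skew and `γ` symmetric; hence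
    -- the factor `-1` passed to the descent.
    have h : ∀ x v w, γ x (structureEndo ω γ x v) w = - γ x v (structureEndo ω γ x w) := by
      intro x v w
      rw [hγ.symm x v, hε, hε, skew_of_alternating hω.alternating]
      ring
    simp only [Function.comp_apply]
    rw [coordBilin_apply, coordBilin_apply, Φ.mfderiv_coordEndo hxz, Φ.mfderiv_coordEndo hxz, h]
    ring
  · intro a ha
    refine c.cod.nondegenerateOn_coordBilin (c.proj_mem z hz) hlam.nondegenerate a trivial
      fun b _ ↦ ?_
    have h1 := (hgf hz hzΦ (H z a) (H z b)).symm.trans (ha b)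
    rwa [hH hz, hpr hz] at h1

end IsMetricReduction

end MetricReduction

end SymplecticReduction

end

/-! ### The proposition -/

open SymplecticReduction in
theorem proposition5p2
    {E : Type*} [NormedAddCommGroup E] [NormedSpace ℝ E] [FiniteDimensional ℝ E]
    {M : Type*} [TopologicalSpace M] [T2Space M] [SecondCountableTopology M]
    [ChartedSpace E M] [IsManifold 𝓘(ℝ, E) ((⊤ : ℕ∞) : WithTop ℕ∞) M]
    (ω γ : Bilin E M) (hω : IsAlmostSymplectic ω) (hγ : IsPseudoMetric γ) :
    -- the structure of `M`
    ((∀ x, sharp ω x ∘L flat γ x = -(sharp γ x ∘L flat ω x)) →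
      IsAlmostHermitian (structureEndo ω γ) γ ω) ∧
    ((∀ x, sharp ω x ∘L flat γ x = sharp γ x ∘L flat ω x) →
      IsAlmostParaHermitian (structureEndo ω γ) γ ω) ∧
    -- the reduction
    ∀ {E' : Type*} [NormedAddCommGroup E'] [NormedSpace ℝ E'] [FiniteDimensional ℝ E']
      {E'' : Type*} [NormedAddCommGroup E''] [NormedSpace ℝ E''] [FiniteDimensional ℝ E'']
      {N : Type*} [TopologicalSpace N] [T2Space N] [SecondCountableTopology N]
      [ChartedSpace E' N] [IsManifold 𝓘(ℝ, E') ((⊤ : ℕ∞) : WithTop ℕ∞) N]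
      {Q : Type*} [TopologicalSpace Q] [T2Space Q] [SecondCountableTopology Q]
      [ChartedSpace E'' Q] [IsManifold 𝓘(ℝ, E'') ((⊤ : ℕ∞) : WithTop ℕ∞) Q]
      (ι : N → M) (p : N → Q) (r : ℕ) (lam : Bilin E'' Q),
      IsSymplecticReduction E' E'' ω ι p r →
      IsPseudoMetric lam →
      IsMetricReduction E' ω γ ι p lam →
      OrthCondition E' ω γ ι →
      ∃ ϖ : Bilin E'' Q,
        IsAlmostSymplectic ϖ ∧
        (∀ ϖ' : Bilin E'' Q, pullback E' p ϖ' = pullback E' ι ω ↔ ϖ' = ϖ) ∧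
        (PositiveDefinite γ → PositiveDefinite lam) ∧
        ((∀ x, sharp ω x ∘L flat γ x = -(sharp γ x ∘L flat ω x)) →
          IsAlmostHermitian (structureEndo ϖ lam) lam ϖ ∧
          (IsKahler (structureEndo ω γ) γ ω → IsKahler (structureEndo ϖ lam) lam ϖ)) ∧
        ((∀ x, sharp ω x ∘L flat γ x = sharp γ x ∘L flat ω x) →
          IsAlmostParaHermitian (structureEndo ϖ lam) lam ϖ ∧
          (IsParaKahler (structureEndo ω γ) γ ω →
            IsParaKahler (structureEndo ϖ lam) lam ϖ)) := by
  -- The sign conditions enter only through these tensor identities, which descend to `Q` with `ε =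
  -- ∓1`.
  have hneg : (∀ x, sharp ω x ∘L flat γ x = -(sharp γ x ∘L flat ω x)) →
      ∀ x v w, γ x (structureEndo ω γ x v) w = - ω x v w :=
    apply_structureEndo_eq_neg hγ.nondegenerate
  have hpos : (∀ x, sharp ω x ∘L flat γ x = sharp γ x ∘L flat ω x) →
      ∀ x v w, γ x (structureEndo ω γ x v) w = ω x v w :=
    apply_structureEndo_eq hγ.nondegenerate
  refine ⟨fun h ↦ isAlmostHermitian_structureEndo hω hγ (hneg h),
    fun h ↦ isAlmostParaHermitian_structureEndo hω hγ (hpos h), ?_⟩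
  intro E' _ _ _ E'' _ _ _ N _ _ _ _ _ Q _ _ _ _ _ ι p r lam hred hlam hmet horth
  obtain ⟨ϖ, hϖ⟩ := hred.exists_reducedForm hω
  have hϖ' := hred.isAlmostSymplectic hϖ hω
  refine ⟨ϖ, hϖ', fun ϖ' ↦ ⟨fun h ↦ hred.pullback_injective (h.trans hϖ.symm), fun h ↦ h ▸ hϖ⟩,
    hmet.positiveDefinite hred, fun h ↦ ?_, fun h ↦ ?_⟩
  · have hε : ∀ x v w, γ x (structureEndo ω γ x v) w = (-1) * ω x v w := fun x v w ↦
      (hneg h x v w).trans (neg_one_mul _).symm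
    have hH := isAlmostHermitian_structureEndo hϖ' hlam fun q u w ↦
      (hmet.apply_structureEndo hred hω hγ horth hϖ hε q u w).trans (neg_one_mul _)
    exact ⟨hH, fun hM ↦ ⟨hH, hmet.nijenhuisVanishes hred hω hγ hlam horth hϖ hε hM.integrable,
      hred.isClosedForm hϖ hω hM.closed⟩⟩
  · have hε : ∀ x v w, γ x (structureEndo ω γ x v) w = 1 * ω x v w := fun x v w ↦
      (hpos h x v w).trans (one_mul _).symm
    have hP := isAlmostParaHermitian_structureEndo hϖ' hlam fun q u w ↦
      (hmet.apply_structureEndo hred hω hγ horth hϖ hε q u w).trans (one_mul _)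
    refine ⟨hP, fun hM ↦ ?_⟩
    -- Integrability passes through the Nijenhuis tensor: from the eigendistributions on `M` to its
    -- vanishing, down to `Q`, and back to eigendistributions.
    have hN := hmet.nijenhuisVanishes hred hω hγ hlam horth hϖ hε
      (nijenhuisVanishes_of_isIntegrable hM.smooth hM.sq hM.integrable_pos hM.integrable_neg)
    exact ⟨hP, hN.isIntegrable_eigenDistribution hP.sq (by norm_num),
      hN.isIntegrable_eigenDistribution hP.sq (by norm_num),
      hred.isClosedForm hϖ hω hM.closed⟩
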